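/- Let $\mathcal A$ be a finite set of linear hyperplanes in $\mathbb R^d$ (a central arrangement), and let $k$ be a field. For each $H\in\mathcal A$ fix a labelling $H^+,H^-$ of the two open half-spaces bounded by $H$, and put $H^0=H$. A *face* is a nonempty set $x=\bigcap_{H\in\mathcal A}H^{\sigma_H(x)}$ with $\sigma_H(x)\in\{+,-,0\}$. The set $\mathcal F$ of faces is partially ordered by $x\le y$ iff for each $H$ either $\sigma_H(x)=0$ or $\sigma_H(x)=\sigma_H(y)$; write $y\gtrdot x$ if $y$ covers $x$. $\mathcal F$ is a monoid under the product with $\sigma_H(xy)=\sigma_H(x)$ if $\sigma_H(x)\ne0$ and $\sigma_H(xy)=\sigma_H(y)$ otherwise; $k\mathcal F$ is its semigroup algebra. The support of $x$ is $\operatorname{supp}(x)=\bigcap_{\sigma_H(x)=0}H$, and $\mathcal L=\operatorname{supp}(\mathcal F)$, ordered by inclusion, is the intersection lattice. For $X\in\mathcal L$ let $\chi_X:k\mathcal F\to k$ be the algebra homomorphism with $\chi_X(y)=1$ if $\operatorname{supp}(y)\le X$ and $\chi_X(y)=0$ otherwise ($y\in\mathcal F$), and let $k_X$ be $k$ as a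 left $k\mathcal F$-module through $\chi_X$. For $Y\in\mathcal L$ let $k\mathcal F_Y$ be the left $k\mathcal F$-module with basis $\{x\in\mathcal F:\operatorname{supp}(x)=Y\}$ and action $y\cdot x=yx$ if $\operatorname{supp}(y)\le Y$, $y\cdot x=0$ otherwise ($y\in\mathcal F$). For $Y\le X$ put $\operatorname{codim}_X(Y)=\dim X-\dim Y$. Fix an orientation $\epsilon_Y$ of every $Y\in\mathcal L$, regarded as a function giving the sign $\pm1$ of each ordered basis of $Y$. If $x$ is a codimension one face of $y$, with $X'=\operatorname{supp}(x)$ and $Y'=\operatorname{supp}(y)$, let $[x:y]=\epsilon_{X'}(e_1,\dots,e_i)\,\epsilon_{Y'}(e_1,\dots,e_i,v)$, where $e_1,\dots,e_i$ is any basis of $X'$ and $v$ is any vector of $y$ (so $[x:y]=\epsilon_{Y'}(e_1,\dots,e_i,v)$ if the basis is positively oriented). **Proposition.** For every $X\in\mathcal L$, the $k\mathcal F$-module $k_X$ is simple, and $$\cdots\longrightarrow\bigoplus_{Y\in\mathcal L,\ Y\le X,\ \operatorname{codim}_X(Y)=p}k\mathcal F_Y\ \xrightarrow{\ \partial\ }\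 \cdots\ \xrightarrow{\ \partial\ }\ \bigoplus_{Y\in\mathcal L,\ Y\le X,\ \operatorname{codim}_X(Y)=1}k\mathcal F_Y\ \xrightarrow{\ \partial\ }\ k\mathcal F_X\longrightarrow k_X\longrightarrow0$$ is a projective resolution of $k_X$ by $k\mathcal F$-modules (the maps are $k\mathcal F$-linear, the terms $\bigoplus k\mathcal F_Y$ are projective, and the sequence is exact), where $\partial(w)=\sum_{y\gtrdot w}[w:y]\,\chi_X(y)\,y$ for each face $w$ in the basis of the terms with $p\ge1$, and $k\mathcal F_X\to k_X$ sends every face of support $X$ to $1$. -/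

import Mathlib

open scoped DirectSum

/-- A central hyperplane arrangement in the real vector space `V`: a finite set of linear
hyperplanes.  For each hyperplane `H` a nonzero linear form with kernel `H` is fixed; it names the
two open half-spaces, `H⁺ = {form H > 0}` and `H⁻ = {form H < 0}`. -/
structure CentralArrangement (V : Type*) [AddCommGroup V] [Module ℝ V] where
  /-- The finite set of hyperplanes. -/
  hyperplanes : Finset (Submodule ℝ V)
  /-- A defining form of each hyperplane. -/
  form : hyperplanes → Module.Dual ℝ V
  form_ne_zero : ∀ H, form H ≠ 0
  ker_form : ∀ H, LinearMap.ker (form H) = H.1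

namespace CentralArrangement

section Faces

variable {V : Type*} [AddCommGroup V] [Module ℝ V]

/-- A face of the arrangement, i.e. a nonempty intersection `⋂ H, H ^ (σ H)` with
`σ H ∈ {+, -, 0}` and `H ^ 0 = H`.  It is recorded by its sign sequence `σ`, which it determines
(the sign sequence of any of its points); the underlying set is `Face.carrier`. -/
@[ext]
structure Face (A : CentralArrangement V) where
  /-- The sign sequence. -/
  sgn : A.hyperplanes → SignType
  nonempty : ∃ v : V, ∀ H, SignType.sign (A.form H v) = sgn H

/-- The support of a face: the intersection of the hyperplanes that contain it. -/
def Face.supp {A : CentralArrangement V} (x : A.Face) : Submodule ℝ V :=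
  ⨅ (H : A.hyperplanes) (_ : x.sgn H = 0), H.1

/-- The intersection lattice: the set of supports of faces, ordered by inclusion. -/
abbrev Flat (A : CentralArrangement V) : Type _ :=
  {X : Submodule ℝ V // X ∈ Set.range (Face.supp (A := A))}

variable {A : CentralArrangement V}

namespace Face

/-- The face as a subset of `V`. -/
def carrier (x : A.Face) : Set V := {v | ∀ H, SignType.sign (A.form H v) = x.sgn H}

theorem carrier_nonempty (x : A.Face) : x.carrier.Nonempty := x.nonempty

theorem sgn_injective : Function.Injective (sgn : A.Face → A.hyperplanes → SignType) :=
  fun _ _ h => Face.ext h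

instance : Finite A.Face := Finite.of_injective _ sgn_injective

noncomputable instance : Fintype A.Face := Fintype.ofFinite _

/-- The face order. -/
instance : PartialOrder A.Face where
  le x y := ∀ H, x.sgn H = 0 ∨ x.sgn H = y.sgn H
  le_refl x H := Or.inr rfl
  le_trans x y z hxy hyz H := by
    rcases hxy H with h | h
    · exact Or.inl h
    · rw [h]; exact hyz H
  le_antisymm x y hxy hyx := by
    apply Face.ext
    funext H
    rcases hxy H with h | h
    · rcases hyx H with h' | h'
      · rw [h, h']
      · exact h'.symm
    · exact h

theorem mem_supp {x : A.Face} {v : V} :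
    v ∈ x.supp ↔ ∀ H, x.sgn H = 0 → A.form H v = 0 := by
  simp only [supp, Submodule.mem_iInf]
  refine forall_congr' fun H => forall_congr' fun _ => ?_
  rw [← A.ker_form H, LinearMap.mem_ker]

theorem mem_supp_of_mem {x : A.Face} {v : V} (hv : v ∈ x.carrier) : v ∈ x.supp :=
  mem_supp.2 fun H hH => sign_eq_zero_iff.1 ((hv H).trans hH)

theorem supp_le_hyperplane {x : A.Face} {H : A.hyperplanes} : x.supp ≤ H.1 ↔ x.sgn H = 0 := by
  constructor
  · intro h
    obtain ⟨v, hv⟩ := x.carrier_nonempty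
    have h1 := h (mem_supp_of_mem hv)
    rw [← A.ker_form H, LinearMap.mem_ker] at h1
    rw [← hv H, h1, sign_zero]
  · intro h
    exact iInf₂_le H h

theorem supp_le_supp {x y : A.Face} : x.supp ≤ y.supp ↔ ∀ H, y.sgn H = 0 → x.sgn H = 0 := by
  constructor
  · intro h H hH
    exact supp_le_hyperplane.1 (h.trans (supp_le_hyperplane.2 hH))
  · intro h
    exact le_iInf₂ fun H hH => supp_le_hyperplane.2 (h H hH)

theorem supp_mono {x y : A.Face} (h : x ≤ y) : x.supp ≤ y.supp :=
  supp_le_supp.2 fun H hH => (h H).elim id fun h' => h'.trans hH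

/-- The flat supporting a face. -/
abbrev flat (x : A.Face) : A.Flat := ⟨x.supp, x, rfl⟩

/-- The product of signs in the face semigroup: the first sign, unless it is zero. -/
def mulSign (s t : SignType) : SignType := if s = 0 then t else s

theorem sign_perturb (a b : ℝ) :
    ∀ᶠ ε in nhdsWithin (0 : ℝ) (Set.Ioi 0),
      SignType.sign (a + ε * b) = mulSign (SignType.sign a) (SignType.sign b) := by
  have hc : Filter.Tendsto (fun ε : ℝ => a + ε * b) (nhdsWithin (0 : ℝ) (Set.Ioi 0)) (nhds a) := by
    have : Continuous fun ε : ℝ => a + ε * b := by fun_prop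
    have h := this.tendsto 0
    simp only [zero_mul, add_zero] at h
    exact h.mono_left nhdsWithin_le_nhds
  rcases lt_trichotomy a 0 with h | h | h
  · filter_upwards [hc.eventually (gt_mem_nhds h)] with ε hε
    simp [mulSign, sign_neg h, sign_neg hε]
  · filter_upwards [self_mem_nhdsWithin] with ε hε
    subst h
    have : SignType.sign ε = 1 := sign_pos hε
    simp [mulSign, sign_mul, this]
  · filter_upwards [hc.eventually (lt_mem_nhds h)] with ε hε
    simp [mulSign, sign_pos h, sign_pos hε]

/-- The product of two faces. -/
instance : Mul A.Face where
  mul x y :=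
    { sgn := fun H => mulSign (x.sgn H) (y.sgn H)
      nonempty := by
        obtain ⟨v, hv⟩ := x.nonempty
        obtain ⟨w, hw⟩ := y.nonempty
        have h := Filter.eventually_all.2 fun H => sign_perturb (A.form H v) (A.form H w)
        obtain ⟨ε, hε⟩ := h.exists
        refine ⟨v + ε • w, fun H => ?_⟩
        rw [← hv H, ← hw H, ← hε H]
        simp }

/-- The identity: the intersection of all the hyperplanes. -/
instance : One A.Face where
  one := { sgn := fun _ => 0, nonempty := ⟨0, fun H => by simp⟩ }

theorem sgn_mul (x y : A.Face) (H : A.hyperplanes) :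
    (x * y).sgn H = if x.sgn H = 0 then y.sgn H else x.sgn H := rfl

theorem sgn_one (H : A.hyperplanes) : (1 : A.Face).sgn H = 0 := rfl

/-- The face semigroup. -/
instance : Monoid A.Face where
  mul_assoc x y z := by
    apply Face.ext
    funext H
    simp only [sgn_mul]
    split_ifs <;> simp_all
  one_mul x := by
    apply Face.ext
    funext H
    simp [sgn_mul, sgn_one]
  mul_one x := by
    apply Face.ext
    funext H
    simp only [sgn_mul, sgn_one]
    split_ifs <;> simp_all

theorem sgn_mul_eq_zero {x y : A.Face} {H : A.hyperplanes} :
    (x * y).sgn H = 0 ↔ x.sgn H = 0 ∧ y.sgn H = 0 := by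
  rw [sgn_mul]
  split_ifs <;> simp_all

theorem supp_mul_le {x y : A.Face} {X : A.Flat} :
    (x * y).supp ≤ X.1 ↔ x.supp ≤ X.1 ∧ y.supp ≤ X.1 := by
  obtain ⟨_, z, rfl⟩ := X
  simp only [supp_le_supp, sgn_mul_eq_zero]
  grind

theorem supp_mul_of_le {x y : A.Face} (h : x.supp ≤ y.supp) : (x * y).supp = y.supp := by
  apply le_antisymm
  · exact (supp_mul_le (X := y.flat)).2 ⟨h, le_rfl⟩
  · exact supp_le_supp.2 fun H hH => (sgn_mul_eq_zero.1 hH).2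

theorem supp_one_le (X : A.Flat) : (1 : A.Face).supp ≤ X.1 := by
  obtain ⟨_, z, rfl⟩ := X
  exact supp_le_supp.2 fun H _ => sgn_one H

end Face

end Faces

noncomputable section Modules

variable {V : Type*} [AddCommGroup V] [Module ℝ V] (A : CentralArrangement V)
variable (k : Type*) [Field k]

/-- The face semigroup algebra `kF`. -/
abbrev FaceAlgebra : Type _ := MonoidAlgebra k A.Face

variable {A}

open Classical in
/-- `χ_X` on faces: `1` if `supp y ≤ X`, and `0` otherwise.  Its linear extension is the character
`χ_X : kF → k`. -/
def chi (X : A.Flat) : A.Face →* k where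
  toFun y := if y.supp ≤ X.1 then 1 else 0
  map_one' := if_pos (Face.supp_one_le X)
  map_mul' x y := by
    simp only [Face.supp_mul_le]
    split_ifs <;> simp_all

/-- The one-dimensional representation of the face semigroup in which `y` acts as `χ_X(y)`. -/
def simpleRep (X : A.Flat) : Representation k A.Face k :=
  (algebraMap k (Module.End k k)).toMonoidHom.comp (chi k X)

/-- The `kF`-module `k_X`: the field `k`, with `kF` acting through `χ_X`. -/
abbrev SimpleMod (X : A.Flat) : Type _ := (simpleRep k X).asModule

/-- The faces of support `Y`. -/
abbrev FaceOn (Y : A.Flat) : Type _ := {x : A.Face // x.supp = Y.1}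

open Classical in
/-- The action of a face `y` on a face `x` of support `Y`: `y · x` is `y x` if `supp y ≤ supp x`,
and `0` otherwise. -/
def faceAct (Y : A.Flat) (y : A.Face) (x : FaceOn Y) : FaceOn Y →₀ k :=
  if h : y.supp ≤ x.1.supp then
    Finsupp.single ⟨y * x.1, (Face.supp_mul_of_le h).trans x.2⟩ 1
  else 0

/-- The representation of the face semigroup on the vector space with basis the faces of
support `Y`. -/
def flatRep (Y : A.Flat) : Representation k A.Face (FaceOn Y →₀ k) where
  toFun y := Finsupp.linearCombination k (faceAct k Y y)
  map_one' := by
    refine Finsupp.lhom_ext' fun x => LinearMap.ext_ring ?_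
    have h : (1 : A.Face).supp ≤ x.1.supp := Face.supp_one_le x.1.flat
    simp [faceAct, h]
  map_mul' y z := by
    refine Finsupp.lhom_ext' fun x => LinearMap.ext_ring ?_
    have hx : (y * z).supp ≤ x.1.supp ↔ y.supp ≤ x.1.supp ∧ z.supp ≤ x.1.supp :=
      Face.supp_mul_le (X := x.1.flat)
    by_cases hz : z.supp ≤ x.1.supp
    · by_cases hy : y.supp ≤ x.1.supp
      · simp [faceAct, hx, hy, hz, Face.supp_mul_of_le hz, mul_assoc]
      · simp [faceAct, hx, hy, hz, Face.supp_mul_of_le hz]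
    · simp [faceAct, hx, hz]

/-- The `kF`-module `kF_Y`. -/
abbrev FlatMod (Y : A.Flat) : Type _ := (flatRep k Y).asModule

/-- The flats `Y ≤ X` with `codim_X(Y) = p`. -/
abbrev FlatOfCodim (X : A.Flat) (p : ℕ) : Type _ :=
  {Y : A.Flat // Y.1 ≤ X.1 ∧ Module.finrank ℝ Y.1 + p = Module.finrank ℝ X.1}

/-- The `p`-th term of the resolution: the `kF`-module `⨁ kF_Y` over the flats `Y` with
`codim_X(Y) = p`. -/
abbrev Term (X : A.Flat) (p : ℕ) : Type _ := ⨁ Y : FlatOfCodim X p, FlatMod k Y.1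

/-- `y` is a face with `supp y ≤ X`, of codimension `p` in `X`. -/
abbrev Face.HasCodimIn (y : A.Face) (X : A.Flat) (p : ℕ) : Prop :=
  y.supp ≤ X.1 ∧ Module.finrank ℝ y.supp + p = Module.finrank ℝ X.1

open Classical in
/-- The face `y`, as a basis element of the `p`-th term (and `0` if `y` is not one of the faces
that span that term). -/
def Term.face (X : A.Flat) (p : ℕ) (y : A.Face) : Term k X p :=
  if h : y.HasCodimIn X p then
    DirectSum.of (fun Y : FlatOfCodim X p => FlatMod k Y.1) ⟨y.flat, h⟩
      ((flatRep k y.flat).asModuleEquiv.symm (Finsupp.single ⟨y, rfl⟩ 1))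
  else 0

variable (A) in
/-- A choice of orientation of every flat. -/
abbrev Orientations : Type _ :=
  ∀ X : A.Flat, Orientation ℝ X.1 (Fin (Module.finrank ℝ X.1))

/-- The sign `ε(v)` of a family of vectors `v` with respect to an orientation, given by any
alternating form that represents the orientation. -/
def orientationSign {M : Type*} [AddCommGroup M] [Module ℝ M] {ι : Type*}
    (o : Orientation ℝ M ι) (v : ι → M) : SignType :=
  SignType.sign (o.someVector v)

/-- A point of the face `y`, as a vector in its support. -/
def Face.point (y : A.Face) : y.supp :=
  ⟨y.carrier_nonempty.some, Face.mem_supp_of_mem y.carrier_nonempty.some_mem⟩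

/-- The family `(e_1, …, e_i, v)` in `supp y`, where `e` is a family in `supp x`, `x ≤ y`, and
`v` is a point of `y`. -/
def Face.extend {x y : A.Face} (h : x ≤ y) {i : ℕ} (e : Fin i → x.supp) : Fin (i + 1) → y.supp :=
  Fin.snoc (α := fun _ => y.supp) (fun j => Submodule.inclusion (Face.supp_mono h) (e j)) y.point

open Classical in
/-- The incidence number `[x : y]` of a codimension one face `x` of `y`: with `X = supp x`,
`Y = supp y`, a basis `e` of `X` and a vector `v` in `y`, it is `ε_X(e) * ε_Y(e, v)`, that is
`ε_Y(e, v)` when `e` is positively oriented.  (The first factor only makes it unnecessary to take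
`e` positively oriented, which is impossible for a negatively oriented zero space.) -/
def incidence [FiniteDimensional ℝ V] (o : A.Orientations) (x y : A.Face) : SignType :=
  if h : x ≤ y ∧ Module.finrank ℝ y.supp = Module.finrank ℝ x.supp + 1 then
    orientationSign (o x.flat) (Module.finBasis ℝ x.supp) *
      orientationSign (o y.flat) (Face.extend h.1 (Module.finBasis ℝ x.supp) ∘ Fin.cast h.2)
  else 0

open Classical in
/-- `∑_{y ⋗ w} [w : y] χ_X(y) y`, as an element of the `p`-th term. -/
def boundaryOfFace [FiniteDimensional ℝ V] (o : A.Orientations) (X : A.Flat) (p : ℕ)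
    (w : A.Face) : Term k X p :=
  ∑ y : A.Face with w ⋖ y, (((incidence o w y : SignType) : k) * chi k X y) • Term.face k X p y

end Modules

end CentralArrangement

/-- `⋯ → P 2 → P 1 → P 0 → M → 0`, with differentials `d p : P (p + 1) → P p` and augmentation `ε`,
is a projective resolution of the `R`-module `M`: every `P p` is projective and the sequence is
exact. -/
structure IsProjectiveResolution {R : Type*} [Ring R] {P : ℕ → Type*} {M : Type*}
    [∀ p, AddCommMonoid (P p)] [∀ p, Module R (P p)] [AddCommMonoid M] [Module R M]
    (d : ∀ p, P (p + 1) →ₗ[R] P p) (ε : P 0 →ₗ[R] M) : Prop where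
  projective : ∀ p, Module.Projective R (P p)
  exact_succ : ∀ p, Function.Exact (d (p + 1)) (d p)
  exact_zero : Function.Exact (d 0) ε
  surjective : Function.Surjective ε

/-! The module `k_X` is simple because it is one-dimensional. For the resolution, an element of a
term is read as a function `c` on faces, which turns `∂` into the coboundary `(δc)(u) = ∑_w [w : u]
c(w)`.

The key fact about incidence numbers is `exists_incidence_eq_mul`: between supports `W ⊂ U` of
codimension one, `[w : u]` is a constant sign times the side of `u` on any hyperplane that contains
`W` but not `U`. Hence the reflection `u ↦ w * -u` of the faces above `w` reverses `[w : u]`, and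
reflected faces cancel in every sum that does not distinguish them (`sum_incidence_smul_eq_zero`).
This gives that augmentation after `∂` is zero, and half of the `kF`-linearity of `∂`: a face `y`
with `supp y ≰ supp w` does not distinguish `u` from `w * -u`, so it kills `∂w`. If `supp y ≤ supp
w`, multiplication by `y` is an incidence-preserving bijection from the faces above `w` to those
above `y * w`. Finally `∂∂ = 0` because exactly two faces lie strictly between faces whose
dimensions differ by two, on opposite sides of a linear form.

Exactness comes from `exists_coboundary_eq`, a stronger statement about all degrees at once and
about the faces of `X` in a cone given by prescribed nonzero signs. The induction is on the number
of hyperplanes that cut `X` and carry no prescribed sign. Take such an `H`. If the cone misses `H`,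
convexity puts everything on one side. Otherwise one solves the problem on `X ⊓ H`, adds a multiple
of a single face of support `X ⊓ H` to balance the sums over the two sides, and solves the remainder
on each side, where the sign on `H` is prescribed.

Projectivity uses the identity `x * y * x = x * y`. The product `e` of the `1 - y` over all `y` with
`supp y ≰ Y` is killed on the left by these `y` and acts as the identity on `kF_Y`. So `z ↦ z e`
embeds `kF_Y` in `kF`, split by `a ↦ a • x` for any face `x` of support `Y`. -/

theorem Fin.snoc_comp_cast {M : Type*} {m n : ℕ} (h : m = n) (a : Fin n → M) (p : M) :
    Fin.snoc (α := fun _ => M) (a ∘ Fin.cast h) p =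
      Fin.snoc (α := fun _ => M) a p ∘ Fin.cast (congrArg (· + 1) h) := by
  subst h; rfl

/-! ### Alternating forms of top degree and proportional linear forms. -/

section Alternating

variable {E : Type*} [AddCommGroup E] [Module ℝ E] [FiniteDimensional ℝ E]

/-- A nonzero top-degree alternating form vanishes exactly on the linearly dependent families. -/
theorem AlternatingMap.apply_ne_zero_iff_linearIndependent {n : ℕ} (F : E [⋀^Fin n]→ₗ[ℝ] ℝ)
    (hF : F ≠ 0) (hn : Module.finrank ℝ E = n) (b : Fin n → E) :
    F b ≠ 0 ↔ LinearIndependent ℝ b := by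
  constructor
  · intro h
    by_contra hb
    exact h (F.map_linearDependent b hb)
  · intro hb h
    have hs := hb.span_eq_top_of_card_eq_finrank' (by simp [hn])
    have h2 := (AlternatingMap.map_basis_eq_zero_iff (Module.Basis.mk hb hs.ge) F).1 (by simpa using h)
    exact hF h2

/-- Fixing the last argument of an alternating map. -/
def AlternatingMap.fixLast {M E' : Type*} [AddCommGroup M] [Module ℝ M] [AddCommGroup E']
    [Module ℝ E'] {n : ℕ} (F : M [⋀^Fin (n + 1)]→ₗ[ℝ] ℝ) (j : E' →ₗ[ℝ] M) (p : M) :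
    E' [⋀^Fin n]→ₗ[ℝ] ℝ where
  toFun v := F (Fin.snoc (α := fun _ => M) (j ∘ v) p)
  map_update_add' v i x y := by
    -- The axiom is stated for an arbitrary decidability instance, which is replaced by the standard
    -- one on `Fin n`.
    rename_i inst
    obtain rfl : inst = instDecidableEqFin n := Subsingleton.elim _ _
    have h (z : E') : j ∘ Function.update v i z = Function.update (j ∘ v) i (j z) := by
      ext k; by_cases hk : k = i
      · subst hk; simp
      · simp [hk]
    rw [h, h, h, Fin.snoc_update, Fin.snoc_update, Fin.snoc_update, map_add]
    exact F.map_update_add _ _ _ _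
  map_update_smul' v i c x := by
    rename_i inst
    obtain rfl : inst = instDecidableEqFin n := Subsingleton.elim _ _
    have h (z : E') : j ∘ Function.update v i z = Function.update (j ∘ v) i (j z) := by
      ext k; by_cases hk : k = i
      · subst hk; simp
      · simp [hk]
    rw [h, h, Fin.snoc_update, Fin.snoc_update, map_smul]
    exact F.map_update_smul _ _ _ _
  map_eq_zero_of_eq' v i k hv hik := by
    refine F.map_eq_zero_of_eq _ (i := i.castSucc) (j := k.castSucc) ?_ ?_
    · simp [hv]
    · simpa using hik

theorem AlternatingMap.fixLast_apply {M E' : Type*} [AddCommGroup M] [Module ℝ M] [AddCommGroup E']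
    [Module ℝ E'] {n : ℕ} (F : M [⋀^Fin (n + 1)]→ₗ[ℝ] ℝ) (j : E' →ₗ[ℝ] M) (p : M)
    (v : Fin n → E') : F.fixLast j p v = F (Fin.snoc (α := fun _ => M) (j ∘ v) p) := rfl

/-- An alternating map as a linear function of its last argument. -/
def AlternatingMap.lastArg {M : Type*} [AddCommGroup M] [Module ℝ M] {n : ℕ}
    (F : M [⋀^Fin (n + 1)]→ₗ[ℝ] ℝ) (e : Fin n → M) : M →ₗ[ℝ] ℝ where
  toFun v := F (Fin.snoc (α := fun _ => M) e v)
  map_add' x y := by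
    have h (z : M) : (Fin.snoc (α := fun _ => M) e z) =
        Function.update (Fin.snoc (α := fun _ => M) e 0) (Fin.last n) z := by
      rw [Fin.update_snoc_last]
    rw [h, h x, h y]
    exact F.map_update_add _ _ _ _
  map_smul' c x := by
    have h (z : M) : (Fin.snoc (α := fun _ => M) e z) =
        Function.update (Fin.snoc (α := fun _ => M) e 0) (Fin.last n) z := by
      rw [Fin.update_snoc_last]
    rw [h, h x]
    exact F.map_update_smul _ _ _ _

theorem AlternatingMap.lastArg_apply {M : Type*} [AddCommGroup M] [Module ℝ M] {n : ℕ}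
    (F : M [⋀^Fin (n + 1)]→ₗ[ℝ] ℝ) (e : Fin n → M) (v : M) :
    F.lastArg e v = F (Fin.snoc (α := fun _ => M) e v) := rfl

/-- Two linear forms with the same kernel on a subspace are proportional there. -/
theorem Module.Dual.exists_eq_mul_of_ker_eq {V : Type*} [AddCommGroup V] [Module ℝ V]
    {W U : Submodule ℝ V} (hWU : W < U) {f g : Module.Dual ℝ V} (hf : ∀ v ∈ U, f v = 0 ↔ v ∈ W)
    (hg : ∀ v ∈ U, g v = 0 ↔ v ∈ W) : ∃ c : ℝ, c ≠ 0 ∧ ∀ v ∈ U, f v = c * g v := by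
  obtain ⟨v₀, hU, hW⟩ := SetLike.exists_of_lt hWU
  have hf0 : f v₀ ≠ 0 := fun h => hW ((hf _ hU).1 h)
  have hg0 : g v₀ ≠ 0 := fun h => hW ((hg _ hU).1 h)
  refine ⟨f v₀ / g v₀, div_ne_zero hf0 hg0, fun v hv => ?_⟩
  -- Subtracting the multiple of `v₀` with the same value of `g` lands in the common kernel `W`.
  have h1 : v - (g v / g v₀) • v₀ ∈ U := U.sub_mem hv (U.smul_mem _ hU)
  have h2 : f (v - (g v / g v₀) • v₀) = 0 := by
    rw [hf _ h1, ← hg _ h1]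
    simp [hg0]
  simp only [map_sub, map_smul, smul_eq_mul] at h2
  field_simp at h2 ⊢
  linarith

end Alternating

namespace CentralArrangement

/-! ### Opposites, products and supports of faces. -/

section Geometry

variable {V : Type*} [AddCommGroup V] [Module ℝ V] {A : CentralArrangement V}

namespace Face

/-- The face that contains a given vector. -/
noncomputable def ofPoint (A : CentralArrangement V) (v : V) : A.Face :=
  ⟨fun H => SignType.sign (A.form H v), v, fun _ => rfl⟩

theorem mem_carrier_ofPoint (v : V) : v ∈ (ofPoint A v).carrier := fun _ => rfl

/-- The opposite face. -/
instance : Neg A.Face where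
  neg x := ⟨fun H => -x.sgn H, by
    obtain ⟨v, hv⟩ := x.nonempty
    exact ⟨-v, fun H => by rw [map_neg, Left.sign_neg, hv]⟩⟩

theorem sgn_neg (x : A.Face) (H : A.hyperplanes) : (-x).sgn H = -x.sgn H := rfl

theorem supp_neg (x : A.Face) : (-x).supp = x.supp := by
  simp [supp, sgn_neg]

theorem point_mem (y : A.Face) : (y.point : V) ∈ y.carrier := y.carrier_nonempty.some_mem

theorem le_mul_right (x y : A.Face) : x ≤ x * y := fun H => by
  rw [sgn_mul]
  split_ifs with h
  · exact Or.inl h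
  · exact Or.inr rfl

theorem mul_eq_of_le {x y : A.Face} (h : x ≤ y) : x * y = y := by
  ext H
  rw [sgn_mul]
  split_ifs with h0
  · rfl
  · exact (h H).resolve_left h0

theorem mul_eq_of_supp_le {x y : A.Face} (h : y.supp ≤ x.supp) : x * y = x := by
  ext H
  rw [sgn_mul]
  split_ifs with h0
  · rw [h0, supp_le_supp.1 h H h0]
  · rfl

/-- The face monoid is a left regular band; the projectivity of the `kF_Y` rests on this identity.
-/
theorem mul_mul_self (x y : A.Face) : x * y * x = x * y :=
  mul_eq_of_supp_le (supp_mono (le_mul_right x y))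

theorem supp_le_mul_right (x y : A.Face) : y.supp ≤ (x * y).supp :=
  supp_le_supp.2 fun _ hH => (sgn_mul_eq_zero.1 hH).2

theorem supp_le_mul_left (x y : A.Face) : x.supp ≤ (x * y).supp := supp_mono (le_mul_right x y)

theorem eq_of_le_of_supp_eq {x y : A.Face} (h : x ≤ y) (hs : y.supp ≤ x.supp) : x = y := by
  rw [← mul_eq_of_le h, mul_eq_of_supp_le hs]

/-- Faces above `w` are determined by their signs on the hyperplanes through `w`. -/
theorem eq_of_le_of_le {w x y : A.Face} (hx : w ≤ x) (hy : w ≤ y)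
    (h : ∀ H, w.sgn H = 0 → x.sgn H = y.sgn H) : x = y := by
  ext H
  by_cases h0 : w.sgn H = 0
  · exact h H h0
  · rw [← (hx H).resolve_left h0, (hy H).resolve_left h0]

/-- `w * -u` is the reflection of `u` through `w`: signs are reversed exactly on the hyperplanes
through `w`. It is therefore an involution of the faces above `w`. -/
theorem mul_neg_mul_neg {w u : A.Face} (h : w ≤ u) : w * -(w * -u) = u := by
  refine eq_of_le_of_le (le_mul_right _ _) h fun H h0 => ?_
  simp [sgn_mul, sgn_neg, h0]

theorem supp_mul_neg {w u : A.Face} (h : w ≤ u) : (w * -u).supp = u.supp := by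
  rw [supp_mul_of_le (by rw [supp_neg]; exact supp_mono h), supp_neg]

end Face

/-- The hyperplane `H` cuts `U` in the subspace `W` of codimension one. -/
theorem form_eq_zero_iff_of_finrank [FiniteDimensional ℝ V] {W U : Submodule ℝ V} (hWU : W ≤ U)
    (hd : Module.finrank ℝ U = Module.finrank ℝ W + 1) {H : A.hyperplanes} (hW : W ≤ H.1)
    (hU : ¬ U ≤ H.1) : ∀ v ∈ U, A.form H v = 0 ↔ v ∈ W := by
  have h1 : W ≤ U ⊓ H.1 := le_inf hWU hW
  have h2 : U ⊓ H.1 < U := lt_of_le_of_ne inf_le_left fun h => hU (inf_eq_left.1 h)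
  have h3 := Submodule.finrank_lt_finrank_of_lt h2
  have h4 : W = U ⊓ H.1 := Submodule.eq_of_le_of_finrank_le h1 (by omega)
  intro v hv
  rw [← LinearMap.mem_ker, A.ker_form H]
  constructor
  · intro h; rw [h4]; exact ⟨hv, h⟩
  · intro h; exact hW h

/-- The orientation form of a flat, with its arguments indexed by `Fin n`. -/
noncomputable def orientationForm (o : A.Orientations) (X : A.Flat) {n : ℕ} (h : Module.finrank ℝ X.1 = n) :
    X.1 [⋀^Fin n]→ₗ[ℝ] ℝ :=
  (o X).someVector.domDomCongr (finCongr h)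

theorem orientationForm_ne_zero (o : A.Orientations) (X : A.Flat) {n : ℕ} (h : Module.finrank ℝ X.1 = n) :
    orientationForm o X h ≠ 0 := by
  subst h
  intro h
  refine (o X).someVector_ne_zero ?_
  ext v
  exact DFunLike.congr_fun h v

theorem lt_of_finrank_eq_succ {W U : Submodule ℝ V} (hWU : W ≤ U)
    (hd : Module.finrank ℝ U = Module.finrank ℝ W + 1) : W < U :=
  lt_of_le_of_ne hWU fun h => by rw [h] at hd; omega

end Geometry

/-! ### Incidence numbers as signs of linear forms. -/

section Incidence

variable {V : Type*} [AddCommGroup V] [Module ℝ V] [FiniteDimensional ℝ V]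
  {A : CentralArrangement V} (o : A.Orientations)

theorem incidence_eq_zero {w u : A.Face}
    (h : ¬ (w ≤ u ∧ Module.finrank ℝ u.supp = Module.finrank ℝ w.supp + 1)) :
    incidence o w u = 0 := dif_neg h

theorem le_of_incidence_ne_zero {w u : A.Face} (h : incidence o w u ≠ 0) : w ≤ u := by
  by_contra h'
  exact h (incidence_eq_zero o fun h'' => h' h''.1)

theorem finrank_of_incidence_ne_zero {w u : A.Face} (h : incidence o w u ≠ 0) :
    Module.finrank ℝ u.supp = Module.finrank ℝ w.supp + 1 := by
  by_contra h'
  exact h (incidence_eq_zero o fun h'' => h' h''.2)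

/-- The linear form on `U` whose sign computes the incidence numbers of the faces of support `W`
in the faces of support `U`. -/
noncomputable def incidenceForm (W U : A.Flat) (hWU : W.1 ≤ U.1)
    (hd : Module.finrank ℝ U.1 = Module.finrank ℝ W.1 + 1) : U.1 →ₗ[ℝ] ℝ :=
  (o W).someVector (Module.finBasis ℝ W.1) •
    (orientationForm o U hd).lastArg (Submodule.inclusion hWU ∘ Module.finBasis ℝ W.1)

theorem someVector_finBasis_ne_zero (W : A.Flat) :
    (o W).someVector (Module.finBasis ℝ W.1) ≠ 0 := fun h =>
  (o W).someVector_ne_zero ((AlternatingMap.map_basis_eq_zero_iff _ _).1 h)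

theorem incidence_eq_sign {w u : A.Face} (h : w ≤ u)
    (hd : Module.finrank ℝ u.supp = Module.finrank ℝ w.supp + 1) :
    incidence o w u = SignType.sign (incidenceForm o w.flat u.flat (Face.supp_mono h) hd u.point) := by
  rw [incidence, dif_pos ⟨h, hd⟩, incidenceForm, LinearMap.smul_apply, smul_eq_mul, sign_mul]
  rfl

theorem linearIndependent_snoc_inclusion {W U : Submodule ℝ V} (hWU : W ≤ U) (v : U) :
    LinearIndependent ℝ (Fin.snoc (α := fun _ => U)
      (Submodule.inclusion hWU ∘ Module.finBasis ℝ W) v) ↔ (v : V) ∉ W := by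
  have hli : LinearIndependent ℝ (Submodule.inclusion hWU ∘ Module.finBasis ℝ W) :=
    (Module.finBasis ℝ W).linearIndependent.map' _ (Submodule.ker_inclusion _ _ hWU)
  rw [linearIndependent_finSnoc, and_iff_right hli, Set.range_comp, Submodule.span_image,
    (Module.finBasis ℝ W).span_eq, Submodule.map_top, Submodule.range_inclusion]
  rfl

/-- A nonzero top-degree form detects linear independence, and a basis of `W` followed by `v` is
dependent exactly when `v ∈ W`. So the incidence form has the same kernel on `U` as a hyperplane
that cuts `U` in `W`. -/
theorem incidenceForm_eq_zero_iff (W U : A.Flat) (hWU : W.1 ≤ U.1)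
    (hd : Module.finrank ℝ U.1 = Module.finrank ℝ W.1 + 1) (v : U.1) :
    incidenceForm o W U hWU hd v = 0 ↔ (v : V) ∈ W.1 := by
  rw [incidenceForm, LinearMap.smul_apply, smul_eq_mul, mul_eq_zero,
    or_iff_right (someVector_finBasis_ne_zero o W), AlternatingMap.lastArg_apply, ← not_iff_not,
    ← linearIndependent_snoc_inclusion hWU v, ← AlternatingMap.apply_ne_zero_iff_linearIndependent
    _ (orientationForm_ne_zero o U hd) hd]

/-- The incidence number is given, up to a sign that depends only on the supports, by the side of
a hyperplane. -/
theorem exists_incidence_eq_mul (W U : A.Flat) (hWU : W.1 ≤ U.1)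
    (hd : Module.finrank ℝ U.1 = Module.finrank ℝ W.1 + 1) {H : A.hyperplanes} (hW : W.1 ≤ H.1)
    (hU : ¬ U.1 ≤ H.1) :
    ∃ s : SignType, s ≠ 0 ∧ ∀ w u : A.Face, w.supp = W.1 → u.supp = U.1 → w ≤ u →
      incidence o w u = s * u.sgn H := by
  obtain ⟨f, hf⟩ := LinearMap.exists_extend (incidenceForm o W U hWU hd)
  have hf' (v : U.1) : f v = incidenceForm o W U hWU hd v := by rw [← hf]; rfl
  -- The constant of proportionality sees only `W`, `U` and `H`; its sign is the required `s`.
  obtain ⟨c, hc, h⟩ := Module.Dual.exists_eq_mul_of_ker_eq (lt_of_finrank_eq_succ hWU hd)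
    (f := f) (g := A.form H) (fun v hv => by
      rw [hf' ⟨v, hv⟩, incidenceForm_eq_zero_iff]) (form_eq_zero_iff_of_finrank hWU hd hW hU)
  refine ⟨SignType.sign c, by simpa using hc, fun w u hw hu hwu => ?_⟩
  obtain rfl : w.flat = W := Subtype.ext hw
  obtain rfl : u.flat = U := Subtype.ext hu
  rw [incidence_eq_sign o hwu hd, ← hf', h _ u.point.2, sign_mul, u.point_mem H]

/-- The incidence numbers along two successive codimension one inclusions. -/
theorem exists_incidence_mul_eq_sign {w z : A.Face} (hwz : w ≤ z)
    (hd : Module.finrank ℝ z.supp = Module.finrank ℝ w.supp + 2) :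
    ∃ D : Module.Dual ℝ V, (∀ v ∈ w.supp, D v = 0) ∧ D z.point = 0 ∧
      (∀ v ∈ z.supp, D v = 0 → ∃ b : ℝ, v - b • (z.point : V) ∈ w.supp) ∧
      (∃ v ∈ z.supp, D v ≠ 0) ∧
      ∀ y : A.Face, w ≤ y → y ≤ z → Module.finrank ℝ y.supp = Module.finrank ℝ w.supp + 1 →
        incidence o w y * incidence o y z = SignType.sign (D y.point) := by
  have hWZ := Face.supp_mono hwz
  set e : Fin (Module.finrank ℝ w.supp) → z.supp :=
    Submodule.inclusion hWZ ∘ Module.finBasis ℝ w.supp with he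
  set F := orientationForm o z.flat hd with hF
  -- `D₀ v` is `ε_w(e) ε_z(e, v, z)`, with `e` a basis of `supp w` and a point of `z` kept in the
  -- last slot. Its kernel is `supp w` plus the line through that point (`hiff`).
  set D₀ : z.supp →ₗ[ℝ] ℝ := (o w.flat).someVector (Module.finBasis ℝ w.supp) •
    (F.fixLast LinearMap.id z.point).lastArg e with hD₀
  have hD₀' (v : z.supp) : D₀ v = (o w.flat).someVector (Module.finBasis ℝ w.supp) *
      F (Fin.snoc (α := fun _ => z.supp) (Fin.snoc (α := fun _ => z.supp) e v) z.point) := rfl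
  have hzero (v : z.supp) : D₀ v ≠ 0 ↔ (v : V) ∉ w.supp ∧
      z.point ∉ Submodule.span ℝ (Set.range (Fin.snoc (α := fun _ => z.supp) e v)) := by
    rw [hD₀', mul_ne_zero_iff, and_iff_right (someVector_finBasis_ne_zero o w.flat),
      AlternatingMap.apply_ne_zero_iff_linearIndependent F (orientationForm_ne_zero o _ _) hd,
      linearIndependent_finSnoc, linearIndependent_snoc_inclusion]
  have hspan (v : z.supp) : Submodule.span ℝ (Set.range (Fin.snoc (α := fun _ => z.supp) e v)) =
      ℝ ∙ v ⊔ w.supp.submoduleOf z.supp := by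
    rw [Fin.range_snoc, Submodule.span_insert, he, Set.range_comp, Submodule.span_image,
      (Module.finBasis ℝ w.supp).span_eq, Submodule.map_top, Submodule.range_inclusion]
    rfl
  have hzw : z.point.1 ∉ w.supp := by
    intro h
    have h1 : z.supp ≤ w.supp := Face.supp_le_supp.2 fun H hH => by
      rw [← z.point_mem H, Face.mem_supp.1 h H hH, sign_zero]
    have := Submodule.finrank_mono h1
    omega
  have hiff (v : z.supp) : D₀ v = 0 ↔ ∃ b : ℝ, (v : V) - b • (z.point : V) ∈ w.supp := by
    rw [← not_iff_not, ← ne_eq, hzero, hspan]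
    constructor
    · rintro ⟨h1, h2⟩ ⟨b, hb⟩
      rcases eq_or_ne b 0 with rfl | hb0
      · exact h1 (by simpa using hb)
      · refine h2 (Submodule.mem_sup.2 ⟨b⁻¹ • v, Submodule.smul_mem _ _
          (Submodule.mem_span_singleton_self v), -(b⁻¹ • (v - b • z.point)), ?_, ?_⟩)
        · exact Submodule.neg_mem _ (Submodule.smul_mem _ _ hb)
        · rw [smul_sub, smul_smul, inv_mul_cancel₀ hb0, one_smul]; abel
    · intro h
      refine ⟨fun h1 => h ⟨0, by simpa using h1⟩, fun h2 => ?_⟩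
      obtain ⟨a, ha, u, hu, hau⟩ := Submodule.mem_sup.1 h2
      obtain ⟨c, rfl⟩ := Submodule.mem_span_singleton.1 ha
      have hu' : (u : V) ∈ w.supp := hu
      have hau' : c • (v : V) + u = z.point := congrArg Subtype.val hau
      rcases eq_or_ne c 0 with rfl | hc
      · rw [zero_smul, zero_add] at hau'
        exact hzw (hau' ▸ hu')
      · refine h ⟨c⁻¹, ?_⟩
        rw [← hau', smul_add, smul_smul, inv_mul_cancel₀ hc, one_smul, sub_add_cancel_left]
        exact Submodule.neg_mem _ (Submodule.smul_mem _ _ hu')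
  obtain ⟨D, hD⟩ := LinearMap.exists_extend D₀
  have hD' (v : z.supp) : D v = D₀ v := by rw [← hD]; rfl
  refine ⟨D, fun v hv => ?_, ?_, fun v hv h => ?_, ?_, fun y hwy hyz hy => ?_⟩
  · rw [hD' ⟨v, hWZ hv⟩, hiff]
    exact ⟨0, by simpa using hv⟩
  · rw [hD', hiff]
    exact ⟨1, by simp⟩
  · rwa [hD' ⟨v, hv⟩, hiff] at h
  · by_contra! hall
    have hle : z.supp ≤ w.supp ⊔ ℝ ∙ (z.point : V) := by
      intro v hv
      have h := hall v hv
      rw [hD' ⟨v, hv⟩, hiff] at h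
      obtain ⟨b, hb⟩ := h
      exact Submodule.mem_sup.2 ⟨_, hb, b • (z.point : V), Submodule.smul_mem _ _
        (Submodule.mem_span_singleton_self _), by simp⟩
    have h1 := Submodule.finrank_mono hle
    have h2 := Submodule.finrank_add_le_finrank_add_finrank w.supp (ℝ ∙ (z.point : V))
    have h3 := finrank_span_le_card (R := ℝ) ({(z.point : V)} : Set V)
    simp only [Set.toFinset_singleton, Finset.card_singleton] at h3
    omega
  · have hdz : Module.finrank ℝ z.supp = Module.finrank ℝ y.supp + 1 := by omega
    set G := (orientationForm o z.flat hdz).fixLast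
      (Submodule.inclusion (Face.supp_mono hyz)) z.point with hG
    set f : Fin (Module.finrank ℝ y.supp) → y.supp :=
      Fin.snoc (α := fun _ => y.supp)
        (Submodule.inclusion (Face.supp_mono hwy) ∘ Module.finBasis ℝ w.supp) y.point ∘
          Fin.cast hy with hf
    set α := (o w.flat).someVector (Module.finBasis ℝ w.supp)
    set β := (o y.flat).someVector (Module.finBasis ℝ y.supp) with hβ
    have hβ0 : β ≠ 0 := someVector_finBasis_ne_zero o y.flat
    have e3 : F (Fin.snoc (α := fun _ => z.supp) (Fin.snoc (α := fun _ => z.supp) e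
        (Submodule.inclusion (Face.supp_mono hyz) y.point)) z.point) = G f := by
      have : Submodule.inclusion (Face.supp_mono hyz) ∘ f =
          Fin.snoc (α := fun _ => z.supp) e (Submodule.inclusion (Face.supp_mono hyz) y.point) ∘
            Fin.cast hy := by
        rw [hf, ← Function.comp_assoc, Fin.comp_snoc]
        rfl
      rw [hG, AlternatingMap.fixLast_apply, this, Fin.snoc_comp_cast]
      rfl
    -- Both forms on `supp y` are multiples of the determinant, so the families `f` and the chosen
    -- basis can be exchanged.
    have e4 : β * G f = G (Module.finBasis ℝ y.supp) * (o y.flat).someVector f := by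
      have h1 := AlternatingMap.eq_smul_basis_det (Module.finBasis ℝ y.supp) G
      have h2 := AlternatingMap.eq_smul_basis_det (Module.finBasis ℝ y.supp) (o y.flat).someVector
      have h1' := DFunLike.congr_fun h1 f
      have h2' := DFunLike.congr_fun h2 f
      rw [AlternatingMap.smul_apply, smul_eq_mul] at h1' h2'
      rw [h1', h2']
      ring
    have hDy : D y.point = α * G f := by
      rw [← e3]
      exact hD' (Submodule.inclusion (Face.supp_mono hyz) y.point)
    have hwy' : incidence o w y = SignType.sign (α * (o y.flat).someVector f) :=
      incidence_eq_sign o hwy hy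
    have hyz' : incidence o y z = SignType.sign (β * G (Module.finBasis ℝ y.supp)) :=
      incidence_eq_sign o hyz hdz
    -- The auxiliary basis of `supp y` enters both incidence numbers, so its contribution is a
    -- positive square.
    have hβ2 : SignType.sign (β * β) = 1 := sign_pos (mul_self_pos.2 hβ0)
    rw [hwy', hyz', hDy, ← sign_mul, ← one_mul (SignType.sign (α * G f)), ← hβ2, ← sign_mul]
    congr 1
    linear_combination -(α * β) * e4

end Incidence

end CentralArrangement

namespace CentralArrangement

/-! ### Faces on the two sides of a hyperplane; intersections of flats with hyperplanes. -/

section Walls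

variable {V : Type*} [AddCommGroup V] [Module ℝ V] {A : CentralArrangement V}

theorem exists_hyperplane_of_not_le {W U : A.Flat} (h : ¬ U.1 ≤ W.1) :
    ∃ H : A.hyperplanes, W.1 ≤ H.1 ∧ ¬ U.1 ≤ H.1 := by
  obtain ⟨_, w, rfl⟩ := W
  by_contra! h'
  exact h (le_iInf₂ fun H hH => h' H (Face.supp_le_hyperplane.2 hH))

/-- A flat that contains `w` and is not contained in `H` supports a face above `w` on either side
of `H`. -/
theorem Face.exists_le_supp_eq {w : A.Face} {U : A.Flat} (hU : w.supp ≤ U.1) {H : A.hyperplanes}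
    (hw : w.sgn H = 0) (hH : ¬ U.1 ≤ H.1) {s : SignType} (hs : s ≠ 0) :
    ∃ u : A.Face, w ≤ u ∧ u.supp = U.1 ∧ u.sgn H = s := by
  obtain ⟨_, x, rfl⟩ := U
  have hx : x.sgn H ≠ 0 := fun h => hH (Face.supp_le_hyperplane.2 h)
  by_cases h : x.sgn H = s
  · exact ⟨w * x, le_mul_right _ _, supp_mul_of_le hU, by simp [sgn_mul, hw, h]⟩
  · refine ⟨w * -x, le_mul_right _ _, ?_, ?_⟩
    · rw [supp_mul_of_le (by rwa [supp_neg]), supp_neg]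
    · simp only [sgn_mul, hw, if_pos, sgn_neg]
      revert hx h hs
      generalize x.sgn H = t
      decide +revert

/-- A face above `w` whose support has dimension one more is determined by its support and its
side of a hyperplane through `w`. -/
theorem Face.eq_of_sgn_eq [FiniteDimensional ℝ V] {w u u' : A.Face} (hu : w ≤ u) (hu' : w ≤ u')
    (hs : u.supp = u'.supp) (hd : Module.finrank ℝ u.supp = Module.finrank ℝ w.supp + 1)
    {H : A.hyperplanes} (hw : w.sgn H = 0) (h0 : u.sgn H ≠ 0) (h : u.sgn H = u'.sgn H) :
    u = u' := by
  refine eq_of_le_of_le hu hu' fun H' hw' => ?_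
  by_cases hH' : u.sgn H' = 0
  · rw [hH', supp_le_supp.1 hs.ge H' hH']
  -- `H` and `H'` both cut `supp u` in `supp w`, so their forms are proportional there.
  · obtain ⟨c, -, hc⟩ := Module.Dual.exists_eq_mul_of_ker_eq
      (lt_of_finrank_eq_succ (supp_mono hu) hd)
      (form_eq_zero_iff_of_finrank (supp_mono hu) hd (supp_le_hyperplane.2 hw')
        fun h => hH' (supp_le_hyperplane.1 h))
      (form_eq_zero_iff_of_finrank (supp_mono hu) hd (supp_le_hyperplane.2 hw)
        fun h => h0 (supp_le_hyperplane.1 h))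
    rw [← u.point_mem H', ← u'.point_mem H', hc _ u.point.2, hc _ (hs.ge u'.point.2), sign_mul,
      sign_mul, u.point_mem H, u'.point_mem H, h]

theorem sign_add_mul_eq {a b x y : ℝ} {s : SignType} (ha : 0 < a) (hb : 0 < b)
    (hx : SignType.sign x = s) (hy : SignType.sign y = s) : SignType.sign (a * x + b * y) = s := by
  rcases lt_trichotomy x 0 with h | h | h
  · have hs : s = -1 := by rw [← hx, sign_neg h]
    subst hs
    have := sign_eq_neg_one_iff.1 hy
    exact sign_neg (by nlinarith)
  · have hs : s = 0 := by rw [← hx, h, sign_zero]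
    subst hs
    have := sign_eq_zero_iff.1 hy
    simp [h, this]
  · have hs : s = 1 := by rw [← hx, sign_pos h]
    subst hs
    have := sign_eq_one_iff.1 hy
    exact sign_pos (by positivity)

/-- A convex combination of points of two faces on different sides of `H` that lies on `H`. -/
theorem Face.exists_sgn_eq_zero_between {x y : A.Face} {H : A.hyperplanes} (hx : x.sgn H = 1)
    (hy : y.sgn H = -1) :
    ∃ z : A.Face, z.sgn H = 0 ∧ ∀ H', x.sgn H' = y.sgn H' → z.sgn H' = x.sgn H' := by
  have h1 : 0 < A.form H x.point := sign_eq_one_iff.1 ((x.point_mem H).trans hx)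
  have h2 : A.form H y.point < 0 := sign_eq_neg_one_iff.1 ((y.point_mem H).trans hy)
  -- The weights are positive and make the two values of the form of `H` cancel.
  refine ⟨ofPoint A ((-A.form H y.point) • (x.point : V) + A.form H x.point • (y.point : V)), ?_, ?_⟩
  · simp only [ofPoint, map_add, map_smul, smul_eq_mul]
    rw [sign_eq_zero_iff]; ring
  · intro H' h
    simp only [ofPoint, map_add, map_smul, smul_eq_mul]
    exact sign_add_mul_eq (by linarith) h1 (x.point_mem H') ((y.point_mem H').trans h.symm)

/-- The intersection of a flat with a hyperplane is a flat. -/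
theorem exists_flat_inf (X : A.Flat) (H : A.hyperplanes) : ∃ Y : A.Flat, Y.1 = X.1 ⊓ H.1 := by
  obtain ⟨_, x, rfl⟩ := X
  -- A product has support containing those of its factors. Multiplying all faces inside the
  -- intersection gives one whose support contains every point of it.
  have key : ∀ s : Finset A.Face, (∀ y ∈ s, y.supp ≤ x.supp ⊓ H.1) →
      ∃ f : A.Face, f.supp ≤ x.supp ⊓ H.1 ∧ ∀ y ∈ s, y.supp ≤ f.supp := by
    classical
    intro s
    induction s using Finset.induction_on with
    | empty =>
      intro _
      refine ⟨1, le_inf (Face.supp_one_le x.flat) ?_, by simp⟩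
      exact Face.supp_le_hyperplane.2 (Face.sgn_one H)
    | insert a s _ ih =>
      intro h
      obtain ⟨f, hf, hfs⟩ := ih fun y hy => h y (Finset.mem_insert_of_mem hy)
      have ha := h a (Finset.mem_insert_self a s)
      refine ⟨a * f, le_inf ?_ ?_, fun y hy => ?_⟩
      · exact (Face.supp_mul_le (X := x.flat)).2 ⟨ha.trans inf_le_left, hf.trans inf_le_left⟩
      · exact Face.supp_le_hyperplane.2 (Face.sgn_mul_eq_zero.2
          ⟨Face.supp_le_hyperplane.1 (ha.trans inf_le_right),
            Face.supp_le_hyperplane.1 (hf.trans inf_le_right)⟩)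
      · rcases Finset.mem_insert.1 hy with rfl | hy
        · exact Face.supp_le_mul_left _ _
        · exact (hfs y hy).trans (Face.supp_le_mul_right _ _)
  classical
  obtain ⟨f, hf, hall⟩ := key (Finset.univ.filter fun y => y.supp ≤ x.supp ⊓ H.1) (by simp)
  refine ⟨f.flat, le_antisymm hf fun v hv => ?_⟩
  refine hall (Face.ofPoint A v) ?_ (Face.mem_supp_of_mem (Face.mem_carrier_ofPoint v))
  simp only [Finset.mem_filter, Finset.mem_univ, true_and]
  refine le_inf (Face.supp_le_supp.2 fun H' hH' => ?_) (Face.supp_le_hyperplane.2 ?_)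
  · exact sign_eq_zero_iff.2 (Face.mem_supp.1 hv.1 H' hH')
  · have : v ∈ LinearMap.ker (A.form H) := by rw [A.ker_form H]; exact hv.2
    exact sign_eq_zero_iff.2 this

end Walls

/-! ### The faces between two faces whose dimensions differ by two. -/

section Diamond

variable {V : Type*} [AddCommGroup V] [Module ℝ V] {A : CentralArrangement V}

/-- The form of a hyperplane through `w` vanishes on `supp w`, so signs there may be computed modulo
`supp w`. -/
theorem Face.sgn_eq_of_form_eq {w x : A.Face} {a b : ℝ} {p q : V}
    (h : (x.point : V) - (a • p + b • q) ∈ w.supp) {H : A.hyperplanes} (hw : w.sgn H = 0) :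
    x.sgn H = SignType.sign (a * A.form H p + b * A.form H q) := by
  have := Face.mem_supp.1 h H hw
  simp only [map_sub, map_add, map_smul, smul_eq_mul] at this
  rw [← x.point_mem H, sub_eq_zero.1 this]

/-- Two faces between `w` and `z`, in codimension one, that lie on the same side of `z` coincide. -/
theorem Face.eq_of_sign_eq_of_between {w z y y' : A.Face} (hy : w ≤ y) (hyz : y ≤ z) (hy' : w ≤ y')
    (hyz' : y' ≤ z) (hne : y ≠ z) (hne' : y' ≠ z) {D : Module.Dual ℝ V}
    (hD : ∀ v ∈ z.supp, D v = 0 → ∃ b : ℝ, v - b • (z.point : V) ∈ w.supp)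
    (h0 : D y.point ≠ 0) (h : SignType.sign (D y.point) = SignType.sign (D y'.point)) : y = y' := by
  have hpos : 0 < D y'.point / D y.point := by
    rw [← sign_eq_one_iff, div_eq_mul_inv, sign_mul, ← h]
    rcases h0.lt_or_gt with h1 | h1
    · rw [sign_neg h1, sign_neg (inv_lt_zero.2 h1)]; rfl
    · rw [sign_pos h1, sign_pos (inv_pos.2 h1)]; rfl
  set a := D y'.point / D y.point with ha
  obtain ⟨b, hb⟩ := hD ((y'.point : V) - a • (y.point : V))
    (Submodule.sub_mem _ (supp_mono hyz' y'.point.2) (Submodule.smul_mem _ _ (supp_mono hyz y.point.2)))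
    (by simp [ha, h0])
  have hb' : (y'.point : V) - (a • (y.point : V) + b • (z.point : V)) ∈ w.supp := by
    rwa [← sub_sub]
  have key (H : A.hyperplanes) (hw : w.sgn H = 0) := Face.sgn_eq_of_form_eq hb' hw
  -- Modulo `supp w`, `y' = a y + b z` with `a > 0`. If `b < 0`, then `y` is a positive combination
  -- of `y'` and `z`, which forces `y = z`; if `b > 0`, likewise `y' = z`.
  rcases lt_trichotomy b 0 with hb0 | hb0 | hb0
  · exfalso
    refine hne (eq_of_le_of_le hy (hyz.trans' hy) fun H hw => ?_)
    have h2 : (y.point : V) - (a⁻¹ • (y'.point : V) + (a⁻¹ * -b) • (z.point : V)) ∈ w.supp := by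
      have := w.supp.smul_mem (-a⁻¹) hb'
      convert this using 1
      rw [smul_sub, smul_add, smul_smul (-a⁻¹) a, neg_mul, inv_mul_cancel₀ hpos.ne']
      module
    have h3 := Face.sgn_eq_of_form_eq h2 hw
    rcases hyz' H with h4 | h4
    · have : A.form H y'.point = 0 := sign_eq_zero_iff.1 ((y'.point_mem H).trans h4)
      rw [h3, this, mul_zero, zero_add, sign_mul,
        sign_pos (mul_pos (inv_pos.2 hpos) (neg_pos.2 hb0)), one_mul, z.point_mem H]
    · rw [h3]
      exact sign_add_mul_eq (inv_pos.2 hpos) (mul_pos (inv_pos.2 hpos) (neg_pos.2 hb0))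
        ((y'.point_mem H).trans h4) (z.point_mem H)
  · refine eq_of_le_of_le hy hy' fun H hw => ?_
    rw [key H hw, hb0, zero_mul, add_zero, sign_mul, sign_pos hpos, one_mul, y.point_mem H]
  · exfalso
    refine hne' (eq_of_le_of_le hy' (hyz.trans' hy) fun H hw => ?_)
    rcases hyz H with h4 | h4
    · have : A.form H y.point = 0 := sign_eq_zero_iff.1 ((y.point_mem H).trans h4)
      rw [key H hw, this, mul_zero, zero_add, sign_mul, sign_pos hb0, one_mul, z.point_mem H]
    · rw [key H hw]
      exact sign_add_mul_eq hpos hb0 ((y.point_mem H).trans h4) (z.point_mem H)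

/-- If `D q = 0`, then `q` is `b z` modulo `supp w`, so on the hyperplanes through `w` the signs of
`y` are `sign b` times those of `z`. As `y ≤ z`, this gives `y = z` for `b > 0` and `y = w` for `b ≤
0`. -/
theorem Face.form_ne_zero_of_between {w z y : A.Face} (hy : w ≤ y) (hyz : y ≤ z)
    (hne : y ≠ z) (hwy : w ≠ y) {D : Module.Dual ℝ V}
    (hD : ∀ v ∈ z.supp, D v = 0 → ∃ b : ℝ, v - b • (z.point : V) ∈ w.supp) {q : V}
    (hqz : q ∈ z.supp) (hq : ∀ H, w.sgn H = 0 → SignType.sign (A.form H q) = y.sgn H) :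
    D q ≠ 0 := by
  intro h
  obtain ⟨b, hb⟩ := hD _ hqz h
  have key (H : A.hyperplanes) (hw : w.sgn H = 0) : y.sgn H = SignType.sign b * z.sgn H := by
    have := Face.mem_supp.1 hb H hw
    rw [map_sub, map_smul, smul_eq_mul, sub_eq_zero] at this
    rw [← hq H hw, this, sign_mul, z.point_mem H]
  rcases lt_trichotomy b 0 with hb0 | hb0 | hb0
  · refine hwy (eq_of_le_of_le le_rfl hy fun H hw => ?_)
    have h1 := key H hw
    rw [sign_neg hb0] at h1
    have h2 := hyz H
    rw [hw]
    revert h1 h2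
    generalize y.sgn H = s
    generalize z.sgn H = t
    decide +revert
  · refine hwy (eq_of_le_of_le le_rfl hy fun H hw => ?_)
    rw [key H hw, hb0, sign_zero, zero_mul, hw]
  · refine hne (eq_of_le_of_le hy (hyz.trans' hy) fun H hw => ?_)
    rw [key H hw, sign_pos hb0, one_mul]

/-- Between `w` and `z` there is a face on either side of `z`. -/
theorem Face.exists_between {w z : A.Face} (hwz : w < z) {D : Module.Dual ℝ V}
    (hw : ∀ v ∈ w.supp, D v = 0) (hz : D z.point = 0) (hD : ∃ v ∈ z.supp, D v ≠ 0) {s : SignType}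
    (hs : s ≠ 0)
    (hker : ∀ v ∈ z.supp, D v = 0 → ∃ b : ℝ, v - b • (z.point : V) ∈ w.supp) :
    ∃ y : A.Face, w ≤ y ∧ y ≤ z ∧ w ≠ y ∧ y ≠ z ∧ SignType.sign (D y.point) = s := by
  classical
  obtain ⟨v, hvz, hvs⟩ : ∃ v ∈ z.supp, SignType.sign (D v) = s := by
    obtain ⟨v, hv, hv0⟩ := hD
    have h0 : SignType.sign (D v) ≠ 0 := by simpa using hv0
    by_cases h : SignType.sign (D v) = s
    · exact ⟨v, hv, h⟩
    · refine ⟨-v, Submodule.neg_mem _ hv, ?_⟩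
      rw [map_neg, Left.sign_neg]
      revert h h0 hs
      generalize SignType.sign (D v) = t
      decide +revert
  set S : Finset A.hyperplanes := Finset.univ.filter fun H => w.sgn H = 0 ∧ z.sgn H ≠ 0 with hS
  have hSne : S.Nonempty := by
    by_contra hempty
    refine hwz.ne (eq_of_le_of_le le_rfl hwz.le fun H h => ?_)
    by_contra hne
    exact hempty ⟨H, Finset.mem_filter.2 ⟨Finset.mem_univ _, h, fun h' => hne (h.trans h'.symm)⟩⟩
  -- Along the line `v + t z`, this is the last crossing of a hyperplane through `w` but not through
  -- `z`. The point `e` there lies on `H₀` and is on the side of `z`, or on the hyperplane, for all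
  -- the others.
  obtain ⟨H₀, hH₀, hmax⟩ := S.exists_max_image (fun H => -A.form H v / A.form H z.point) hSne
  set t := -A.form H₀ v / A.form H₀ z.point with ht
  set e := v + t • (z.point : V) with he
  have hpz (H : A.hyperplanes) (h : z.sgn H ≠ 0) : A.form H z.point ≠ 0 := fun h' =>
    h (by rw [← z.point_mem H, h', sign_zero])
  have hform (H : A.hyperplanes) (h : z.sgn H ≠ 0) : SignType.sign (A.form H e) =
      SignType.sign (t - -A.form H v / A.form H z.point) * z.sgn H := by
    rw [← z.point_mem H, ← sign_mul, he, map_add, map_smul, smul_eq_mul]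
    congr 1
    have := hpz H h
    field_simp
    ring
  simp only [hS, Finset.mem_filter, Finset.mem_univ, true_and] at hH₀ hmax
  have hez : e ∈ z.supp := Submodule.add_mem _ hvz (Submodule.smul_mem _ _ z.point.2)
  have hDe : D e = D v := by rw [he, map_add, map_smul, hz, smul_zero, add_zero]
  have hysgn (H : A.hyperplanes) (h : w.sgn H = 0) :
      (w * ofPoint A e).sgn H = SignType.sign (A.form H e) := by
    rw [sgn_mul, if_pos h]; rfl
  have hyz : w * ofPoint A e ≤ z := by
    intro H
    by_cases h : w.sgn H = 0
    · rw [hysgn H h]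
      by_cases h' : z.sgn H = 0
      · left
        rw [mem_supp.1 hez H h', sign_zero]
      · rw [hform H h']
        rcases (hmax H ⟨h, h'⟩).eq_or_lt with h1 | h1
        · left
          rw [h1, sub_self, sign_zero, zero_mul]
        · right
          rw [sign_pos (sub_pos.2 h1), one_mul]
    · right
      rw [sgn_mul, if_neg h]
      exact (hwz.le H).resolve_left h
  have hne : w * ofPoint A e ≠ z := fun h => hH₀.2 <| by
    rw [← h, hysgn _ hH₀.1, hform _ hH₀.2, ← ht, sub_self, sign_zero, zero_mul]
  have hDv : D v ≠ 0 := by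
    rw [← hvs] at hs
    simpa using hs
  have hwy : w ≠ w * ofPoint A e := fun h => hDv <| by
    rw [← hDe]
    refine hw _ (mem_supp.2 fun H hH => ?_)
    rw [← sign_eq_zero_iff, ← hysgn H hH, ← h, hH]
  refine ⟨w * ofPoint A e, le_mul_right _ _, hyz, hwy, hne, ?_⟩
  set y := w * ofPoint A e with hy
  have hDy : D y.point ≠ 0 := form_ne_zero_of_between (le_mul_right _ _) hyz hne hwy hker
    (supp_mono hyz y.point.2) fun H _ => y.point_mem H
  -- The chosen point of `y` need not be `e`. If `D` had opposite signs at the two, a positive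
  -- combination of them would have the signs of `y` on the hyperplanes through `w` and still be
  -- killed by `D`.
  by_contra hcon
  have hopp : D y.point / D e < 0 := by
    rw [← sign_eq_neg_one_iff, div_eq_mul_inv, sign_mul]
    rw [← hDe] at hvs hDv
    rw [← hvs] at hcon
    rcases hDy.lt_or_gt with h1 | h1 <;> rcases hDv.lt_or_gt with h2 | h2
    · exact absurd (by rw [sign_neg h1, sign_neg h2]) hcon
    · rw [sign_neg h1, sign_pos (inv_pos.2 h2)]; rfl
    · rw [sign_pos h1, sign_neg (inv_lt_zero.2 h2)]; rfl
    · exact absurd (by rw [sign_pos h1, sign_pos h2]) hcon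
  refine form_ne_zero_of_between (le_mul_right _ _) hyz hne hwy hker
    (q := (1 : ℝ) • (y.point : V) + (-(D y.point / D e)) • e) ?_ (fun H hH => ?_) ?_
  · exact Submodule.add_mem _ (Submodule.smul_mem _ _ (supp_mono hyz y.point.2))
      (Submodule.smul_mem _ _ hez)
  · simp only [map_add, map_smul, smul_eq_mul]
    exact sign_add_mul_eq one_pos (neg_pos.2 hopp) (y.point_mem H) (hysgn H hH).symm
  · rw [← hDe] at hDv
    simp [hDv]

end Diamond

end CentralArrangement

namespace CentralArrangement

/-! ### Cancellation of opposite faces and the coboundary operator. -/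

section Coboundary

variable {V : Type*} [AddCommGroup V] [Module ℝ V] [FiniteDimensional ℝ V]
  {A : CentralArrangement V} (o : A.Orientations)

/-- If `[w : u]` is nonzero, there is a hyperplane through `w` and not through `u` whose sides
determine, up to a common sign, all incidence numbers between the supports of `w` and `u`. -/
theorem exists_hyperplane_of_incidence_ne_zero {w u : A.Face} (h : incidence o w u ≠ 0) :
    ∃ H : A.hyperplanes, w.sgn H = 0 ∧ u.sgn H ≠ 0 ∧ ∃ s : SignType, s ≠ 0 ∧
      ∀ w' u' : A.Face, w'.supp = w.supp → u'.supp = u.supp → w' ≤ u' →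
        incidence o w' u' = s * u'.sgn H := by
  have hwu := le_of_incidence_ne_zero o h
  have hd := finrank_of_incidence_ne_zero o h
  have hlt := lt_of_finrank_eq_succ (Face.supp_mono hwu) hd
  obtain ⟨H, hW, hU⟩ := exists_hyperplane_of_not_le (W := w.flat) (U := u.flat) hlt.not_ge
  exact ⟨H, Face.supp_le_hyperplane.1 hW, fun h => hU (Face.supp_le_hyperplane.2 h),
    exists_incidence_eq_mul o w.flat u.flat (Face.supp_mono hwu) hd hW hU⟩

/-- Reflection through `w` preserves supports and changes the side of a hyperplane through `w`,
which determines the incidence number up to a constant sign. -/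
theorem incidence_mul_neg {w u : A.Face} (h : w ≤ u) :
    incidence o w (w * -u) = -incidence o w u := by
  have key {u : A.Face} (hu : w ≤ u) (h : incidence o w u ≠ 0) :
      incidence o w (w * -u) = -incidence o w u := by
    obtain ⟨H, hw, -, s, -, hinc⟩ := exists_hyperplane_of_incidence_ne_zero o h
    rw [hinc _ _ rfl (Face.supp_mul_neg hu) (Face.le_mul_right _ _), hinc _ _ rfl rfl hu,
      Face.sgn_mul, if_pos hw, Face.sgn_neg, mul_neg]
  by_cases h0 : incidence o w u = 0
  · by_cases h1 : incidence o w (w * -u) = 0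
    · rw [h0, h1]; rfl
    · have := key (Face.le_mul_right _ _) h1
      rw [Face.mul_neg_mul_neg h, h0] at this
      exact absurd (SignType.neg_eq_zero_iff.1 this.symm) h1
  · exact key h h0

/-- The faces above `w` cancel in pairs in any sum that does not distinguish opposite faces. -/
theorem sum_incidence_smul_eq_zero (k : Type*) [Field k] {M : Type*} [AddCommMonoid M] [Module k M]
    (w : A.Face) (g : A.Face → M) (hg : ∀ u, incidence o w u ≠ 0 → g (w * -u) = g u) :
    ∑ u, (incidence o w u : k) • g u = 0 := by
  classical
  have h1 : ∑ u, (incidence o w u : k) • g u =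
      ∑ u with w ≤ u, (incidence o w u : k) • g u := by
    refine (Finset.sum_filter_of_ne fun u _ h => ?_).symm
    by_contra h'
    exact h (by rw [incidence_eq_zero o fun h'' => h' h''.1, SignType.coe_zero, zero_smul])
  rw [h1]
  refine Finset.sum_involution (fun u _ => w * -u) (fun u hu => ?_) (fun u hu h h' => ?_)
    (fun u _ => by simp [Face.le_mul_right]) (fun u hu => Face.mul_neg_mul_neg (by simpa using hu))
  · have hwu : w ≤ u := by simpa using hu
    by_cases h0 : incidence o w u = 0
    · rw [incidence_mul_neg o hwu, h0]; simp
    · rw [incidence_mul_neg o hwu, hg u h0, SignType.coe_neg, ← add_smul, add_neg_cancel, zero_smul]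
  · have hwu : w ≤ u := by simpa using hu
    have h2 := incidence_mul_neg o hwu
    rw [h', SignType.self_eq_neg_iff] at h2
    exact h (by rw [h2, SignType.coe_zero, zero_smul])

/-- The diamond relation. -/
theorem sum_incidence_mul_incidence (k : Type*) [Field k] (w z : A.Face) :
    ∑ y, (incidence o w y : k) * (incidence o y z : k) = 0 := by
  by_cases h : w ≤ z ∧ Module.finrank ℝ z.supp = Module.finrank ℝ w.supp + 2
  · obtain ⟨hwz, hd⟩ := h
    obtain ⟨D, hDw, hDz, hker, hne, hinc⟩ := exists_incidence_mul_eq_sign o hwz hd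
    have hlt : w < z := lt_of_le_of_ne hwz fun h => by rw [h] at hd; omega
    have hdim {y : A.Face} (h1 : w ≤ y) (h2 : y ≤ z) (h3 : w ≠ y) (h4 : y ≠ z) :
        Module.finrank ℝ y.supp = Module.finrank ℝ w.supp + 1 := by
      have h5 : w.supp < y.supp := lt_of_le_of_ne (Face.supp_mono h1) fun h =>
        h3 (Face.eq_of_le_of_supp_eq h1 h.ge)
      have h6 : y.supp < z.supp := lt_of_le_of_ne (Face.supp_mono h2) fun h =>
        h4 (Face.eq_of_le_of_supp_eq h2 h.ge)
      have := Submodule.finrank_lt_finrank_of_lt h5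
      have := Submodule.finrank_lt_finrank_of_lt h6
      omega
    obtain ⟨y₁, h1w, h1z, h1w', h1z', h1s⟩ :=
      Face.exists_between hlt hDw hDz hne (s := 1) (by decide) hker
    obtain ⟨y₂, h2w, h2z, h2w', h2z', h2s⟩ :=
      Face.exists_between hlt hDw hDz hne (s := -1) (by decide) hker
    -- Each product is the sign of `D` at a point of the middle face, so `y₁` and `y₂` contribute
    -- `1` and `-1`. Any other contributing face would be on the same side as one of them, hence
    -- equal to it.
    rw [Fintype.sum_eq_add y₁ y₂]
    · rw [← SignType.coe_mul, ← SignType.coe_mul, hinc _ h1w h1z (hdim h1w h1z h1w' h1z'),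
        hinc _ h2w h2z (hdim h2w h2z h2w' h2z'), h1s, h2s]
      simp
    · rintro rfl
      rw [h1s] at h2s
      exact absurd h2s (by decide)
    · rintro y ⟨hy1, hy2⟩
      by_contra hprod
      have hiw : incidence o w y ≠ 0 := fun h => hprod (by rw [h]; simp)
      have hiz : incidence o y z ≠ 0 := fun h => hprod (by rw [h]; simp)
      have hwy := le_of_incidence_ne_zero o hiw
      have hyz := le_of_incidence_ne_zero o hiz
      have hdy := finrank_of_incidence_ne_zero o hiw
      have hyz' : y ≠ z := fun h => by rw [h] at hdy; omega
      have hD0 : SignType.sign (D y.point) ≠ 0 := by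
        rw [← hinc y hwy hyz hdy]; exact mul_ne_zero hiw hiz
      rcases (SignType.sign (D y.point)).trichotomy with hs | hs | hs
      · exact hy2 (Face.eq_of_sign_eq_of_between hwy hyz h2w h2z hyz' h2z' hker
          (by simpa using hD0) (hs.trans h2s.symm))
      · exact hD0 hs
      · exact hy1 (Face.eq_of_sign_eq_of_between hwy hyz h1w h1z hyz' h1z' hker
          (by simpa using hD0) (hs.trans h1s.symm))
  · refine Finset.sum_eq_zero fun y _ => ?_
    by_contra hprod
    have hiw : incidence o w y ≠ 0 := fun h => hprod (by rw [h]; simp)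
    have hiz : incidence o y z ≠ 0 := fun h => hprod (by rw [h]; simp)
    refine h ⟨(le_of_incidence_ne_zero o hiw).trans (le_of_incidence_ne_zero o hiz), ?_⟩
    rw [finrank_of_incidence_ne_zero o hiz, finrank_of_incidence_ne_zero o hiw]

variable (k : Type*) [Field k]

/-- The coboundary operator on functions on the faces. -/
noncomputable def coboundary : (A.Face → k) →ₗ[k] (A.Face → k) where
  toFun c u := ∑ w, (incidence o w u : k) * c w
  map_add' c c' := by ext u; simp [mul_add, Finset.sum_add_distrib]
  map_smul' a c := by ext u; simp [Finset.mul_sum, mul_left_comm]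

theorem coboundary_apply (c : A.Face → k) (u : A.Face) :
    coboundary o k c u = ∑ w, (incidence o w u : k) * c w := rfl

theorem coboundary_coboundary (c : A.Face → k) : coboundary o k (coboundary o k c) = 0 := by
  ext z
  simp only [coboundary_apply, Finset.mul_sum]
  rw [Finset.sum_comm]
  refine Finset.sum_eq_zero fun w _ => ?_
  have := congrArg (· * c w) (sum_incidence_mul_incidence o k w z)
  simp only [zero_mul, Finset.sum_mul] at this
  rw [← this]
  exact Finset.sum_congr rfl fun y _ => by ring

variable {k}

theorem coboundary_congr {c c' : A.Face → k} {u : A.Face}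
    (h : ∀ w, incidence o w u ≠ 0 → c w = c' w) : coboundary o k c u = coboundary o k c' u := by
  rw [coboundary_apply, coboundary_apply]
  refine Finset.sum_congr rfl fun w _ => ?_
  by_cases h0 : incidence o w u = 0
  · rw [h0]; simp
  · rw [h w h0]

theorem coboundary_eq_zero {c : A.Face → k} {u : A.Face}
    (h : ∀ w, incidence o w u ≠ 0 → c w = 0) : coboundary o k c u = 0 := by
  rw [coboundary_congr o (c' := 0) h, map_zero, Pi.zero_apply]

theorem exists_of_coboundary_ne_zero {c : A.Face → k} {u : A.Face} (h : coboundary o k c u ≠ 0) :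
    ∃ w, incidence o w u ≠ 0 ∧ c w ≠ 0 := by
  by_contra! h'
  exact h (coboundary_eq_zero o h')

open Classical in
-- Opposite faces above `w` have the same support, so they cancel; this is the vanishing of the
-- augmentation on boundaries.
theorem sum_coboundary_supp_eq (X : A.Flat) (b : A.Face → k) :
    ∑ u with u.supp = X.1, coboundary o k b u = 0 := by
  simp only [coboundary_apply]
  rw [Finset.sum_comm]
  refine Finset.sum_eq_zero fun w _ => ?_
  rw [Finset.sum_filter]
  refine (Finset.sum_congr rfl fun u _ => ?_).trans (sum_incidence_smul_eq_zero o k w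
    (fun u => if u.supp = X.1 then b w else 0) fun u hu => ?_)
  · split_ifs <;> simp
  · simp only [Face.supp_mul_neg (le_of_incidence_ne_zero o hu)]

open Classical in
/-- The sum of the coboundary of `b` over the faces of support `X` on one side of `H` is, up to
sign, the sum of `b` over the faces of support `X ⊓ H`. -/
theorem exists_sum_coboundary_eq (X Y : A.Flat) (H : A.hyperplanes) (hX : ¬ X.1 ≤ H.1)
    (hY : Y.1 = X.1 ⊓ H.1) :
    ∃ s : SignType, s ≠ 0 ∧ ∀ (t : SignType), t ≠ 0 → ∀ b : A.Face → k,
      ∑ u with u.supp = X.1 ∧ u.sgn H = t, coboundary o k b u =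
        (s : k) * (t : k) * ∑ w with w.supp = Y.1, b w := by
  have hYX : Y.1 ≤ X.1 := hY.le.trans inf_le_left
  have hYH : Y.1 ≤ H.1 := hY.le.trans inf_le_right
  have hd : Module.finrank ℝ X.1 = Module.finrank ℝ Y.1 + 1 := by
    have hne : (A.form H).domRestrict X.1 ≠ 0 := fun h => hX fun v hv => by
      rw [← A.ker_form H]
      exact LinearMap.congr_fun h ⟨v, hv⟩
    have hker : LinearMap.ker ((A.form H).domRestrict X.1) = Y.1.comap X.1.subtype := by
      ext v
      rw [Submodule.mem_comap, hY, Submodule.subtype_apply, Submodule.mem_inf, ← A.ker_form H]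
      simp
    rw [← Module.Dual.finrank_ker_add_one_of_ne_zero hne, hker,
      (Submodule.comapSubtypeEquivOfLe hYX).finrank_eq]
  obtain ⟨s, hs, hinc⟩ := exists_incidence_eq_mul o Y X hYX hd hYH hX
  refine ⟨s, hs, fun t ht b => ?_⟩
  simp only [coboundary_apply]
  rw [Finset.sum_comm, Finset.mul_sum, Finset.sum_filter (fun w : A.Face => w.supp = Y.1)]
  refine Finset.sum_congr rfl fun w _ => ?_
  rw [Finset.sum_filter]
  split_ifs with hw
  -- Exactly one face of support `X` above `w` lies on the prescribed side of `H`.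
  · have hwH : w.sgn H = 0 := Face.supp_le_hyperplane.1 (hw.le.trans hYH)
    obtain ⟨u, hwu, huX, hut⟩ := Face.exists_le_supp_eq (hw.le.trans hYX) hwH hX ht
    rw [Finset.sum_eq_single u]
    · rw [if_pos ⟨huX, hut⟩, hinc w u hw huX hwu, hut, SignType.coe_mul]
    · intro u' _ hne
      rw [ite_eq_right_iff]
      rintro ⟨h1, h2⟩
      by_cases hwu' : w ≤ u'
      · refine absurd (Face.eq_of_sgn_eq hwu' hwu (h1.trans huX.symm) ?_ hwH (h2 ▸ ht)
          (h2.trans hut.symm)) hne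
        rw [h1, hw, hd]
      · rw [incidence_eq_zero o fun h => hwu' h.1]; simp
    · simp
  · by_cases hwH : w.sgn H = 0
    -- A face on `H` of codimension one in a face of support `X` would have support `Y`, by
    -- dimension.
    · refine Finset.sum_eq_zero fun u _ => ?_
      rw [ite_eq_right_iff]
      rintro ⟨h1, h2⟩
      by_cases h0 : incidence o w u = 0
      · rw [h0]; simp
      · exfalso
        have hwu := le_of_incidence_ne_zero o h0
        have hdu := finrank_of_incidence_ne_zero o h0
        refine hw (Submodule.eq_of_le_of_finrank_le ?_ ?_)
        · rw [hY]
          exact le_inf (h1 ▸ Face.supp_mono hwu) (Face.supp_le_hyperplane.2 hwH)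
        · rw [h1] at hdu; omega
    -- Off `H`, every face above `w` is on the side of `w`, so the condition on the side depends on
    -- `w` alone and opposite faces cancel.
    · refine (Finset.sum_congr rfl fun u _ => ?_).trans (sum_incidence_smul_eq_zero o k w
        (fun u => if u.supp = X.1 ∧ w.sgn H = t then b w else 0) fun u hu => ?_)
      · by_cases h0 : incidence o w u = 0
        · rw [h0]; simp
        · rw [(le_of_incidence_ne_zero o h0 H).resolve_left hwH]
          split_ifs <;> simp
      · simp only [Face.supp_mul_neg (le_of_incidence_ne_zero o hu)]

end Coboundary

end CentralArrangement

namespace CentralArrangement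

/-! ### Exactness for the faces in a cone. -/

section Acyclic

variable {V : Type*} [AddCommGroup V] [Module ℝ V] {A : CentralArrangement V}

/-- The faces of support at most `X` whose signs agree with those of `τ` wherever `τ` is nonzero:
the faces of the restriction to `X` inside an open polyhedral cone. -/
def Face.InRegion (w : A.Face) (X : A.Flat) (τ : A.hyperplanes → SignType) : Prop :=
  w.supp ≤ X.1 ∧ ∀ H, τ H ≠ 0 → w.sgn H = τ H

theorem Face.InRegion.mono {w u : A.Face} {X : A.Flat} {τ : A.hyperplanes → SignType}
    (h : w.InRegion X τ) (hwu : w ≤ u) (hu : u.supp ≤ X.1) : u.InRegion X τ :=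
  ⟨hu, fun H hH => by
    rw [← h.2 H hH]
    exact ((hwu H).resolve_left (h.2 H hH ▸ hH)).symm⟩

theorem Face.inRegion_update [DecidableEq A.hyperplanes] {w : A.Face} {X : A.Flat}
    {τ : A.hyperplanes → SignType} (h : w.InRegion X τ) {H : A.hyperplanes} {t : SignType}
    (hw : w.sgn H = t) : w.InRegion X (Function.update τ H t) :=
  ⟨h.1, fun H' hH' => by
    by_cases hH : H' = H
    · subst hH; simpa using hw
    · rw [Function.update_of_ne hH] at hH' ⊢
      exact h.2 H' hH'⟩

theorem Face.InRegion.of_update [DecidableEq A.hyperplanes] {w : A.Face} {X : A.Flat}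
    {τ : A.hyperplanes → SignType} {H : A.hyperplanes} {t : SignType}
    (h : w.InRegion X (Function.update τ H t)) (hH : τ H = 0) : w.InRegion X τ :=
  ⟨h.1, fun H' hH' => by
    have hne : H' ≠ H := fun h' => hH' (h' ▸ hH)
    have := h.2 H'
    rw [Function.update_of_ne hne] at this
    exact this hH'⟩

variable [FiniteDimensional ℝ V] (o : A.Orientations) (k : Type*) [Field k]

theorem coe_mul_self_eq_one {s : SignType} (hs : s ≠ 0) : (s : k) * (s : k) = 1 := by
  rw [← SignType.coe_mul]
  revert hs
  rcases s.trichotomy with rfl | rfl | rfl <;> simp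

open Classical in
/-- The augmented complex of the faces in a region is exact. -/
theorem exists_coboundary_eq (n : ℕ) : ∀ (X : A.Flat) (τ : A.hyperplanes → SignType),
    (Finset.univ.filter fun H : A.hyperplanes => τ H = 0 ∧ ¬ X.1 ≤ H.1).card ≤ n →
    ∀ c : A.Face → k, (∀ w, c w ≠ 0 → w.InRegion X τ) →
      (∀ u : A.Face, u.supp ≤ X.1 → coboundary o k c u = 0) →
      ∑ u with u.supp = X.1, c u = 0 →
      ∃ b : A.Face → k, (∀ w, b w ≠ 0 → w.InRegion X τ) ∧
        ∀ u : A.Face, u.supp ≤ X.1 → coboundary o k b u = c u := by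
  induction n with
  | zero =>
    -- All signs are determined, so `c` is concentrated on at most one face, of support `X`, and the
    -- vanishing sum makes it zero.
    intro X τ hcard c hc _ hsum
    have hτ (H : A.hyperplanes) (hH : τ H = 0) : X.1 ≤ H.1 := by
      by_contra h
      exact Finset.filter_eq_empty_iff.1 (Finset.card_eq_zero.1 (Nat.le_zero.1 hcard))
        (Finset.mem_univ H) ⟨hH, h⟩
    have hsupp {u : A.Face} (hu : c u ≠ 0) : u.supp = X.1 := by
      refine le_antisymm (hc u hu).1 (le_iInf₂ fun H hH => hτ H ?_)
      by_contra h
      exact h (((hc u hu).2 H h).symm.trans hH)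
    have huniq {u v : A.Face} (hu : c u ≠ 0) (hv : c v ≠ 0) : u = v := by
      ext H
      by_cases h : τ H = 0
      · rw [Face.supp_le_hyperplane.1 ((hc u hu).1.trans (hτ H h)),
          Face.supp_le_hyperplane.1 ((hc v hv).1.trans (hτ H h))]
      · rw [(hc u hu).2 H h, (hc v hv).2 H h]
    refine ⟨0, fun w hw => absurd rfl hw, fun u _ => ?_⟩
    rw [map_zero, Pi.zero_apply]
    by_contra hu
    refine hu (Eq.symm ?_)
    rw [← hsum]
    refine (Finset.sum_eq_single u (fun v _ hvu => ?_) fun h => ?_).symm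
    · by_contra hv
      exact hvu (huniq hv (Ne.symm hu))
    · exact absurd (by simpa using hsupp (Ne.symm hu)) h
  | succ n ih =>
    intro X τ hcard c hc hδ hsum
    by_cases hH : ∃ H, τ H = 0 ∧ ¬ X.1 ≤ H.1
    swap
    · refine ih X τ ?_ c hc hδ hsum
      rw [Finset.card_eq_zero.2 (Finset.filter_eq_empty_iff.2 fun H _ h => hH ⟨H, h⟩)]
      exact Nat.zero_le n
    obtain ⟨H, hτH, hXH⟩ := hH
    have hcardlt {Y : A.Flat} {τ' : A.hyperplanes → SignType}
        (h1 : ∀ H', τ' H' = 0 ∧ ¬ Y.1 ≤ H'.1 → τ H' = 0 ∧ ¬ X.1 ≤ H'.1)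
        (h2 : ¬ (τ' H = 0 ∧ ¬ Y.1 ≤ H.1)) :
        (Finset.univ.filter fun H : A.hyperplanes => τ' H = 0 ∧ ¬ Y.1 ≤ H.1).card ≤ n := by
      refine Nat.le_of_lt_succ (lt_of_lt_of_le (Finset.card_lt_card ?_) hcard)
      rw [Finset.ssubset_iff_of_subset (fun H' h => by simpa using h1 H' (by simpa using h))]
      exact ⟨H, by simp [hτH, hXH], by simpa using h2⟩
    have hcardu {t : SignType} (ht : t ≠ 0) : (Finset.univ.filter fun H' : A.hyperplanes =>
        Function.update τ H t H' = 0 ∧ ¬ X.1 ≤ H'.1).card ≤ n := by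
      refine hcardlt (fun H' h => ⟨?_, h.2⟩) (by simp [ht])
      by_cases hne : H' = H
      · exact hne ▸ hτH
      · simpa [Function.update_of_ne hne] using h.1
    have hside {t : SignType} (ht : t ≠ 0) (hall : ∀ w, c w ≠ 0 → w.sgn H = t) :
        ∃ b : A.Face → k, (∀ w, b w ≠ 0 → w.InRegion X τ) ∧
          ∀ u : A.Face, u.supp ≤ X.1 → coboundary o k b u = c u := by
      obtain ⟨b, hb, hbc⟩ := ih X (Function.update τ H t) (hcardu ht) c
        (fun w hw => Face.inRegion_update (hc w hw) (hall w hw)) hδ hsum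
      exact ⟨b, fun w hw => (hb w hw).of_update hτH, hbc⟩
    by_cases hex : ∃ w : A.Face, w.InRegion X τ ∧ w.sgn H = 0
    swap
    · push Not at hex
      -- The region misses `H`. If `c` were nonzero on both sides, a point between the two faces
      -- would give a face of the region on `H`.
      by_cases hpos : ∃ w, c w ≠ 0 ∧ w.sgn H = 1
      · obtain ⟨x, hx, hx1⟩ := hpos
        refine hside (t := 1) (by decide) fun w hw => ?_
        rcases (w.sgn H).trichotomy with h | h | h
        · exfalso
          obtain ⟨z, hz, hz'⟩ := Face.exists_sgn_eq_zero_between hx1 h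
          refine hex z ⟨?_, fun H' h' => ?_⟩ hz
          · obtain ⟨⟨_, f, rfl⟩, hX⟩ : ∃ X', X' = X := ⟨X, rfl⟩
            subst hX
            refine Face.supp_le_supp.2 fun H' h' => ?_
            have h1 := Face.supp_le_supp.1 (hc x hx).1 H' h'
            rw [hz' H' (h1.trans (Face.supp_le_supp.1 (hc w hw).1 H' h').symm), h1]
          · rw [hz' H' (((hc x hx).2 H' h').trans ((hc w hw).2 H' h').symm), (hc x hx).2 H' h']
        · exact absurd h (hex w (hc w hw))
        · exact h
      · refine hside (t := -1) (by decide) fun w hw => ?_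
        rcases (w.sgn H).trichotomy with h | h | h
        · exact h
        · exact absurd h (hex w (hc w hw))
        · exact absurd ⟨w, hw, h⟩ hpos
    obtain ⟨w₁, hw₁, hw₁H⟩ := hex
    obtain ⟨Y, hY⟩ := exists_flat_inf X H
    have hYX : Y.1 ≤ X.1 := hY.le.trans inf_le_left
    have hYH : Y.1 ≤ H.1 := hY.le.trans inf_le_right
    have hleY {u : A.Face} (hu : u.supp ≤ X.1) (h : u.sgn H = 0) : u.supp ≤ Y.1 := by
      rw [hY]; exact le_inf hu (Face.supp_le_hyperplane.2 h)
    have hzero {w u : A.Face} (hwu : w ≤ u) (h : u.sgn H = 0) : w.sgn H = 0 :=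
      (hwu H).elim id fun h' => h'.trans h
    have hsuppX {w u : A.Face} (h : incidence o w u ≠ 0) (hu : u.supp ≤ X.1) : w.supp ≤ X.1 :=
      (Face.supp_mono (le_of_incidence_ne_zero o h)).trans hu
    -- a face of full support in the part of the region on `H`
    obtain ⟨w₀, hw₀, hw₀Y⟩ : ∃ w₀ : A.Face, w₀.InRegion Y τ ∧ w₀.supp = Y.1 := by
      obtain ⟨⟨_, f, rfl⟩, hY'⟩ : ∃ Y', Y' = Y := ⟨Y, rfl⟩
      subst hY'
      have h1 : w₁.InRegion f.flat τ := ⟨hleY hw₁.1 hw₁H, hw₁.2⟩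
      have h2 := Face.supp_mul_of_le h1.1
      exact ⟨w₁ * f, h1.mono (Face.le_mul_right _ _) h2.le, h2⟩
    obtain ⟨s, hs, hhalf⟩ := exists_sum_coboundary_eq o (k := k) X Y H hXH hY
    -- the part of `c` on `H` is a coboundary
    obtain ⟨b₀, hb₀, hb₀c⟩ := ih Y τ
      (hcardlt (fun H' h => ⟨h.1, fun h' => h.2 (hYX.trans h')⟩) fun h => h.2 hYH)
      (fun u => if u.sgn H = 0 then c u else 0)
      (fun w hw => by
        have hw' : w.sgn H = 0 ∧ c w ≠ 0 := by simpa using hw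
        exact ⟨hleY (hc w hw'.2).1 hw'.1, (hc w hw'.2).2⟩)
      (fun u hu => by
        rw [← hδ u (hu.trans hYX)]
        refine coboundary_congr o fun w hw => if_pos ?_
        exact hzero (le_of_incidence_ne_zero o hw) (Face.supp_le_hyperplane.1 (hu.trans hYH)))
      (by
        -- Up to sign, the sum of `c` over the support `Y` is the sum of its coboundary over one
        -- side of `H`, which is zero.
        have h1 := hhalf 1 (by decide) c
        rw [Finset.sum_eq_zero fun u hu => hδ u (by simp_all)] at h1
        have h2 : (s : k) ≠ 0 := fun h => by
          have := coe_mul_self_eq_one k hs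
          simp [h] at this
        have h3 : ∑ w with w.supp = Y.1, c w = 0 := by
          simpa [h2] using h1.symm
        rw [← h3]
        refine Finset.sum_congr rfl fun u hu => if_pos ?_
        exact Face.supp_le_hyperplane.1 ((Finset.mem_filter.1 hu).2.le.trans hYH))
    -- This multiple of `w₀` makes the coboundary of `B` have the same sum as `c` over the positive
    -- side, since `s * s = 1`.
    set a : k := s * (∑ u with u.supp = X.1 ∧ u.sgn H = 1, c u) - ∑ w with w.supp = Y.1, b₀ w
      with ha
    set e : A.Face → k := Pi.single w₀ a with he
    set B : A.Face → k := b₀ + e with hB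
    have hBY (w) (hw : B w ≠ 0) : w.InRegion Y τ := by
      by_cases h : w = w₀
      · exact h ▸ hw₀
      · exact hb₀ w (by simpa [hB, he, h] using hw)
    have hBsum : ∑ w with w.supp = Y.1, B w = s * ∑ u with u.supp = X.1 ∧ u.sgn H = 1, c u := by
      have : ∑ w with w.supp = Y.1, e w = a := by
        rw [he, Finset.sum_pi_single', if_pos (by simpa using hw₀Y)]
      simp only [hB, Pi.add_apply, Finset.sum_add_distrib, this, ha]
      ring
    have hBc {u : A.Face} (hu : u.supp ≤ X.1) (h : u.sgn H = 0) : coboundary o k B u = c u := by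
      -- `w₀` has full support `Y`, so no face of larger dimension lies above it within `Y`: the
      -- correction is invisible on `H`.
      have h1 : coboundary o k e u = 0 := coboundary_eq_zero o fun w hw => by
        rw [he]
        refine Pi.single_eq_of_ne (fun hw' => ?_) _
        have h2 := finrank_of_incidence_ne_zero o hw
        have h3 := Submodule.finrank_mono (hleY hu h)
        rw [hw', hw₀Y] at h2
        omega
      rw [hB, map_add, Pi.add_apply, h1, add_zero, hb₀c u (hleY hu h), if_pos h]
    have hpart (t : SignType) (ht : t ≠ 0)
        (hsumt : ∑ u with u.supp = X.1 ∧ u.sgn H = t, (c u - coboundary o k B u) = 0) :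
        ∃ b : A.Face → k, (∀ w, b w ≠ 0 → w.InRegion X (Function.update τ H t)) ∧
          ∀ u : A.Face, u.supp ≤ X.1 → coboundary o k b u =
            if u.supp ≤ X.1 ∧ u.sgn H = t then c u - coboundary o k B u else 0 := by
      -- The cut-off to one side is still a cocycle: a face below one on side `t` is on the same
      -- side or on `H`, where the coboundary of `B` already equals `c`.
      refine ih X (Function.update τ H t) (hcardu ht) _ (fun w hw => ?_) (fun u hu => ?_) ?_
      · rw [ne_eq, ite_eq_right_iff, not_forall] at hw
        obtain ⟨⟨hwX, hwt⟩, hw⟩ := hw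
        refine Face.inRegion_update ?_ hwt
        by_cases hcw : c w = 0
        · rw [hcw, zero_sub, neg_eq_zero] at hw
          obtain ⟨x, hx, hx'⟩ := exists_of_coboundary_ne_zero o hw
          exact Face.InRegion.mono ⟨(hBY x hx').1.trans hYX, (hBY x hx').2⟩
            (le_of_incidence_ne_zero o hx) hwX
        · exact hc w hcw
      · by_cases hut : u.sgn H = t
        · have h1 : coboundary o k (c - coboundary o k B) u = 0 := by
            rw [map_sub, coboundary_coboundary, sub_zero, hδ u hu]
          refine (coboundary_congr o fun w hw => ?_).trans h1
          have hwX := hsuppX hw hu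
          rcases le_of_incidence_ne_zero o hw H with h | h
          · rw [if_neg fun h' => ht (h'.2.symm.trans h), Pi.sub_apply, hBc hwX h, sub_self]
          · rw [if_pos ⟨hwX, h.trans hut⟩, Pi.sub_apply]
        · refine coboundary_eq_zero o fun w hw => if_neg fun h => hut ?_
          rw [← h.2]
          exact ((le_of_incidence_ne_zero o hw H).resolve_left (h.2 ▸ ht)).symm
      · refine Eq.trans ?_ hsumt
        rw [← Finset.filter_filter, Finset.sum_filter (fun u : A.Face => u.sgn H = t)]
        refine Finset.sum_congr rfl fun u hu => ?_
        have hu' : u.supp ≤ X.1 := (Finset.mem_filter.1 hu).2.le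
        simp only [hu', true_and]
    have hss := coe_mul_self_eq_one k hs
    have hsplit : (∑ u with u.supp = X.1 ∧ u.sgn H = 1, c u) +
        ∑ u with u.supp = X.1 ∧ u.sgn H = -1, c u = 0 := by
      rw [← hsum, ← Finset.sum_union]
      · refine Finset.sum_congr ?_ fun _ _ => rfl
        ext u
        simp only [Finset.mem_union, Finset.mem_filter, Finset.mem_univ, true_and, ← and_or_left,
          and_iff_left_iff_imp]
        intro hu
        rcases (u.sgn H).trichotomy with h | h | h
        · exact Or.inr h
        · exact absurd (hu.ge.trans (Face.supp_le_hyperplane.2 h)) hXH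
        · exact Or.inl h
      · refine Finset.disjoint_left.2 fun u hu hu' => ?_
        have := (Finset.mem_filter.1 hu).2.2.symm.trans (Finset.mem_filter.1 hu').2.2
        exact absurd this (by decide)
    obtain ⟨b₁, hb₁, hb₁c⟩ := hpart 1 (by decide) (by
      rw [Finset.sum_sub_distrib, hhalf 1 (by decide), hBsum, SignType.coe_one, mul_one,
        ← mul_assoc, hss, one_mul, sub_self])
    -- The negative side now balances by itself: the sums of `c` over the two sides are opposite,
    -- and so are those of the coboundary of `B`.
    obtain ⟨b₂, hb₂, hb₂c⟩ := hpart (-1) (by decide) (by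
      rw [Finset.sum_sub_distrib, hhalf (-1) (by decide), hBsum, SignType.coe_neg,
        SignType.coe_one]
      linear_combination hsplit +
        (∑ u with u.supp = X.1 ∧ u.sgn H = 1, c u) * hss)
    refine ⟨B + b₁ + b₂, fun w hw => ?_, fun u hu => ?_⟩
    · by_cases h0 : B w = 0
      · by_cases h1 : b₁ w = 0
        · exact (hb₂ w (by simpa [h0, h1] using hw)).of_update hτH
        · exact (hb₁ w h1).of_update hτH
      · exact ⟨(hBY w h0).1.trans hYX, (hBY w h0).2⟩
    · rw [map_add, map_add, Pi.add_apply, Pi.add_apply, hb₁c u hu, hb₂c u hu]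
      rcases (u.sgn H).trichotomy with h | h | h
      · simp [hu, h]
      · simp [h, hBc hu h]
      · simp [hu, h]

end Acyclic

end CentralArrangement

namespace CentralArrangement

/-! ### Simplicity of `k_X` and projectivity of `kF_Y`. -/

section FlatModules

variable {V : Type*} [AddCommGroup V] [Module ℝ V] {A : CentralArrangement V}
  (k : Type*) [Field k]

theorem flatRep_single (Y : A.Flat) (y : A.Face) (x : FaceOn Y) :
    flatRep k Y y (Finsupp.single x 1) = faceAct k Y y x := by
  change Finsupp.linearCombination k (faceAct k Y y) (Finsupp.single x 1) = _
  simp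

theorem simpleRep_apply (X : A.Flat) (y : A.Face) (a : k) : simpleRep k X y a = chi k X y * a := rfl

theorem isSimpleModule_simpleMod (X : A.Flat) :
    IsSimpleModule (A.FaceAlgebra k) (SimpleMod k X) := by
  have : Nontrivial (SimpleMod k X) := inferInstanceAs (Nontrivial k)
  rw [isSimpleModule_iff_toSpanSingleton_surjective]
  refine ⟨this, fun m hm n => ?_⟩
  refine ⟨algebraMap k _ ((simpleRep k X).asModuleEquiv n / (simpleRep k X).asModuleEquiv m), ?_⟩
  have hm' : (simpleRep k X).asModuleEquiv m ≠ 0 := by simpa using hm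
  apply (simpleRep k X).asModuleEquiv.injective
  rw [LinearMap.toSpanSingleton_apply, algebraMap_smul, map_smul, smul_eq_mul,
    div_mul_cancel₀ _ hm']

theorem single_mul_mul_single (y : A.Face) (a : A.FaceAlgebra k) :
    (MonoidAlgebra.single y 1 : A.FaceAlgebra k) * a * MonoidAlgebra.single y 1 =
      MonoidAlgebra.single y 1 * a := by
  induction a using MonoidAlgebra.induction_on with
  | of x =>
    rw [MonoidAlgebra.of_apply, MonoidAlgebra.single_mul_single, MonoidAlgebra.single_mul_single,
      Face.mul_mul_self]
    simp
  | add a b ha hb => rw [mul_add, add_mul, ha, hb]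
  | smul r a ha => rw [mul_smul_comm, smul_mul_assoc, ha]

theorem single_smul_flatMod (Y : A.Flat) (y : A.Face) (v : FaceOn Y →₀ k) :
    (MonoidAlgebra.single y 1 : A.FaceAlgebra k) • (flatRep k Y).asModuleEquiv.symm v =
      (flatRep k Y).asModuleEquiv.symm (flatRep k Y y v) := by
  rw [Representation.asModuleEquiv_symm_map_rho]; rfl

theorem single_smul_eq_zero {Y : A.Flat} {y : A.Face} (hy : ¬ y.supp ≤ Y.1) (m : FlatMod k Y) :
    (MonoidAlgebra.single y 1 : A.FaceAlgebra k) • m = 0 := by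
  obtain ⟨v, rfl⟩ := (flatRep k Y).asModuleEquiv.symm.surjective m
  have h : flatRep k Y y = 0 := by
    refine Finsupp.lhom_ext' fun x => LinearMap.ext_ring ?_
    rw [LinearMap.comp_apply, Finsupp.lsingle_apply, flatRep_single, faceAct, dif_neg]
    · rfl
    · rwa [x.2]
  rw [single_smul_flatMod, h, LinearMap.zero_apply, map_zero]

/-- An element of the face algebra killed on the left by the faces that are not contained in `X`,
and acting as the identity on `kF_X`. -/
theorem exists_faceAlgebra_killed (X : A.Flat) : ∃ e : A.FaceAlgebra k,
    (∀ y : A.Face, ¬ y.supp ≤ X.1 → MonoidAlgebra.single y 1 * e = 0) ∧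
      ∀ m : FlatMod k X, e • m = m := by
  classical
  set f : A.Face → A.FaceAlgebra k := fun y => 1 - MonoidAlgebra.single y 1 with hf
  have key (l : List A.Face) (hl : ∀ y ∈ l, ¬ y.supp ≤ X.1) (m : FlatMod k X) :
      (l.map f).prod • m = m := by
    induction l with
    | nil => simp
    | cons y l ih =>
      rw [List.map_cons, List.prod_cons, mul_smul, ih fun z hz => hl z (List.mem_cons_of_mem _ hz)]
      have h : f y • m + (MonoidAlgebra.single y 1 : A.FaceAlgebra k) • m = m := by
        rw [← add_smul, sub_add_cancel, one_smul]
      rwa [single_smul_eq_zero k (hl y List.mem_cons_self), add_zero] at h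
  refine ⟨((Finset.univ.filter fun y : A.Face => ¬ y.supp ≤ X.1).toList.map f).prod,
    fun y hy => ?_, key _ (by simp)⟩
  -- With `a` the product of the factors before `1 - y`, one has `y a (1 - y) = y a - y a y = 0`,
  -- whatever the order of the factors.
  obtain ⟨l₁, l₂, h⟩ := List.append_of_mem
    (show y ∈ (Finset.univ.filter fun y : A.Face => ¬ y.supp ≤ X.1).toList by simpa using hy)
  rw [h, List.map_append, List.map_cons, List.prod_append, List.prod_cons, ← mul_assoc,
    ← mul_assoc, hf, mul_sub, mul_one, single_mul_mul_single, sub_self, zero_mul]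

/-- A direct summand of `kF`: `z ↦ z e` followed by `a ↦ a • x` sends `z` to `z • (e • x) = z * x =
z`, as `x` and `z` have the same support. -/
theorem projective_flatMod (Y : A.Flat) : Module.Projective (A.FaceAlgebra k) (FlatMod k Y) := by
  classical
  obtain ⟨e, he, he'⟩ := exists_faceAlgebra_killed k Y
  obtain ⟨x, hx⟩ : ∃ x : A.Face, x.supp = Y.1 := Y.2
  let s : A.FaceAlgebra k →ₗ[A.FaceAlgebra k] FlatMod k Y := LinearMap.toSpanSingleton _ _
    ((flatRep k Y).asModuleEquiv.symm (Finsupp.single ⟨x, hx⟩ 1))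
  let f : (FaceOn Y →₀ k) →ₗ[k] A.FaceAlgebra k :=
    Finsupp.linearCombination k fun z => MonoidAlgebra.single z.1 1 * e
  have hf (z : FaceOn Y) : f (Finsupp.single z 1) = MonoidAlgebra.single z.1 1 * e := by
    simp [f]
  have hcomm (y : A.Face) : f ∘ₗ flatRep k Y y =
      LinearMap.mulLeft k (MonoidAlgebra.single y 1) ∘ₗ f := by
    refine Finsupp.lhom_ext' fun z => LinearMap.ext_ring ?_
    simp only [LinearMap.comp_apply, Finsupp.lsingle_apply, flatRep_single, hf,
      LinearMap.mulLeft_apply]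
    rw [← mul_assoc, MonoidAlgebra.single_mul_single, mul_one, faceAct]
    split_ifs with h
    · rw [hf]
    -- Here `y • z = 0` in `kF_Y`, and `(y z) e = 0` since the support of `y z` is not contained in
    -- `Y`.
    · rw [map_zero, he]
      intro h'
      exact h (z.2.symm ▸ (Face.supp_mul_le.1 h').1)
  let i : FlatMod k Y →ₗ[A.FaceAlgebra k] A.FaceAlgebra k :=
    MonoidAlgebra.equivariantOfLinearOfComm (f ∘ₗ (flatRep k Y).asModuleEquiv.toLinearMap)
      fun y m => by
        obtain ⟨v, rfl⟩ := (flatRep k Y).asModuleEquiv.symm.surjective m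
        rw [single_smul_flatMod]
        exact LinearMap.congr_fun (hcomm y) v
  have hi (v : FaceOn Y →₀ k) : i ((flatRep k Y).asModuleEquiv.symm v) = f v := by
    change f ((flatRep k Y).asModuleEquiv ((flatRep k Y).asModuleEquiv.symm v)) = f v
    rw [LinearEquiv.apply_symm_apply]
  refine Module.Projective.of_split i s (LinearMap.ext fun m => ?_)
  obtain ⟨v, rfl⟩ := (flatRep k Y).asModuleEquiv.symm.surjective m
  rw [LinearMap.comp_apply, hi, LinearMap.id_apply]
  have : s.restrictScalars k ∘ₗ f = (flatRep k Y).asModuleEquiv.symm.toLinearMap := by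
    refine Finsupp.lhom_ext' fun z => LinearMap.ext_ring ?_
    simp only [LinearMap.comp_apply, Finsupp.lsingle_apply, hf, LinearMap.coe_restrictScalars,
      LinearEquiv.coe_coe]
    rw [LinearMap.toSpanSingleton_apply, mul_smul, he', single_smul_flatMod, flatRep_single,
      faceAct, dif_pos (z.2.trans hx.symm).le]
    congr 2
    exact Subtype.ext (Face.mul_eq_of_supp_le (hx.trans z.2.symm).le)
  exact LinearMap.congr_fun this v

end FlatModules

/-! ### Elements of the terms as functions on faces. -/

section Terms

variable {V : Type*} [AddCommGroup V] [Module ℝ V] {A : CentralArrangement V}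
  {k : Type*} [Field k] {X : A.Flat} {p : ℕ}

instance : IsScalarTower k (A.FaceAlgebra k) (Term k X p) where
  smul_assoc a r t := by
    ext Y : 1
    rw [DirectSum.smul_apply, DirectSum.smul_apply, DirectSum.smul_apply, smul_assoc]

namespace Term

open Classical in
/-- The coefficients of an element of a term of the resolution, as a function on all faces. -/
noncomputable def coeff : Term k X p →ₗ[k] (A.Face → k) where
  toFun t w := if h : w.HasCodimIn X p then
    (flatRep k w.flat).asModuleEquiv (t ⟨w.flat, h⟩) ⟨w, rfl⟩ else 0
  map_add' t t' := by
    ext w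
    by_cases h : w.HasCodimIn X p
    · simp only [Pi.add_apply, dif_pos h, DirectSum.add_apply, map_add, Finsupp.add_apply]
    · simp only [Pi.add_apply, dif_neg h, add_zero]
  map_smul' a t := by
    ext w
    by_cases h : w.HasCodimIn X p
    · simp only [Pi.smul_apply, dif_pos h, DirectSum.smul_apply, map_smul, Finsupp.smul_apply,
        RingHom.id_apply]
    · simp only [Pi.smul_apply, dif_neg h, smul_zero]

theorem coeff_of_hasCodimIn (t : Term k X p) {w : A.Face} (h : w.HasCodimIn X p) :
    coeff t w = (flatRep k w.flat).asModuleEquiv (t ⟨w.flat, h⟩) ⟨w, rfl⟩ := dif_pos h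

theorem coeff_of_not {t : Term k X p} {w : A.Face} (h : ¬ w.HasCodimIn X p) : coeff t w = 0 :=
  dif_neg h

theorem asModuleEquiv_apply (t : Term k X p) (Y : FlatOfCodim X p) (x : FaceOn Y.1) :
    (flatRep k Y.1).asModuleEquiv (t Y) x = coeff t x.1 := by
  -- The flat of a face is only propositionally equal to `Y`, so the submodule is generalised until
  -- it can be substituted.
  have h (Z : Submodule ℝ V) (hZ : Z ∈ Set.range (Face.supp (A := A)))
      (hc : Z ≤ X.1 ∧ Module.finrank ℝ Z + p = Module.finrank ℝ X.1) (x : A.Face)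
      (hx : x.supp = Z) :
      (flatRep k (⟨Z, hZ⟩ : A.Flat)).asModuleEquiv (t ⟨⟨Z, hZ⟩, hc⟩) ⟨x, hx⟩ = coeff t x := by
    subst hx
    exact (coeff_of_hasCodimIn t hc).symm
  exact h Y.1.1 Y.1.2 Y.2 x.1 x.2

theorem coeff_injective : Function.Injective (coeff : Term k X p →ₗ[k] (A.Face → k)) := by
  intro t t' h
  ext Y : 1
  apply (flatRep k Y.1).asModuleEquiv.injective
  ext x
  rw [asModuleEquiv_apply, asModuleEquiv_apply, h]

theorem face_eq_zero {w : A.Face} (h : ¬ w.HasCodimIn X p) : Term.face k X p w = 0 := dif_neg h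

open Classical in
theorem face_eq_of {w : A.Face} (Y : FlatOfCodim X p) (h : w.supp = Y.1.1) :
    Term.face k X p w = DirectSum.of (fun Y : FlatOfCodim X p => FlatMod k Y.1) Y
      ((flatRep k Y.1).asModuleEquiv.symm (Finsupp.single ⟨w, h⟩ 1)) := by
  obtain ⟨⟨Y, hY⟩, hc⟩ := Y
  dsimp only at h
  subst h
  exact dif_pos hc

open Classical in
theorem coeff_face {w : A.Face} (h : w.HasCodimIn X p) :
    coeff (Term.face k X p w) = Pi.single w 1 := by
  ext u
  by_cases hu : u.HasCodimIn X p
  · rw [← asModuleEquiv_apply _ ⟨u.flat, hu⟩ ⟨u, rfl⟩]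
    by_cases hs : w.supp = u.supp
    · rw [face_eq_of ⟨u.flat, hu⟩ hs, DirectSum.of_eq_same, LinearEquiv.apply_symm_apply,
        Finsupp.single_apply, Pi.single_apply]
      simp [eq_comm]
    · rw [face_eq_of ⟨w.flat, h⟩ rfl, DirectSum.of_eq_of_ne, map_zero, Finsupp.zero_apply,
        Pi.single_eq_of_ne]
      · rintro rfl; exact hs rfl
      · intro h'; exact hs (congrArg (fun Y => Y.1.1) h').symm
  · rw [coeff_of_not hu, Pi.single_eq_of_ne]
    rintro rfl; exact hu h

theorem coeff_sum_smul_face (c : A.Face → k) (u : A.Face) (hu : u.HasCodimIn X p) :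
    coeff (∑ w, c w • Term.face k X p w) u = c u := by
  classical
  rw [map_sum, Finset.sum_apply, Finset.sum_eq_single u]
  · rw [map_smul, coeff_face hu]; simp
  · intro w _ hw
    rw [map_smul]
    by_cases h : w.HasCodimIn X p
    · rw [coeff_face h]; simp [hw.symm]
    · rw [face_eq_zero h]; simp
  · simp

theorem sum_coeff_smul_face (t : Term k X p) : ∑ w, coeff t w • Term.face k X p w = t := by
  apply coeff_injective
  ext u
  by_cases hu : u.HasCodimIn X p
  · exact coeff_sum_smul_face _ u hu
  · rw [coeff_of_not hu, coeff_of_not hu]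

open Classical in
theorem single_smul_face (y w : A.Face) :
    (MonoidAlgebra.single y 1 : A.FaceAlgebra k) • Term.face k X p w =
      if y.supp ≤ w.supp then Term.face k X p (y * w) else 0 := by
  by_cases h : w.HasCodimIn X p
  · rw [face_eq_of ⟨w.flat, h⟩ rfl]
    have hsm := ((DirectSum.lof (A.FaceAlgebra k) _ (fun Y : FlatOfCodim X p => FlatMod k Y.1)
      ⟨w.flat, h⟩).map_smul (MonoidAlgebra.single y 1)
      ((flatRep k w.flat).asModuleEquiv.symm (Finsupp.single ⟨w, rfl⟩ 1))).symm
    rw [DirectSum.lof_eq_of] at hsm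
    refine hsm.trans ?_
    rw [single_smul_flatMod, flatRep_single, faceAct]
    split_ifs with hy
    · rw [face_eq_of ⟨w.flat, h⟩ (Face.supp_mul_of_le hy)]
      rfl
    · simp
  · rw [face_eq_zero h, smul_zero]
    split_ifs with hy
    · rw [face_eq_zero]
      rwa [Face.HasCodimIn, Face.supp_mul_of_le hy]
    · rfl

end Term

/-- The sum of the coefficients. -/
noncomputable def augmentationLinear (k : Type*) [Field k] (X : A.Flat) : Term k X 0 →ₗ[k] k :=
  (∑ w : A.Face, LinearMap.proj w) ∘ₗ Term.coeff

theorem augmentationLinear_apply (t : Term k X 0) :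
    augmentationLinear k X t = ∑ w, Term.coeff t w := by
  simp [augmentationLinear]

theorem augmentationLinear_face {w : A.Face} (hw : w.HasCodimIn X 0) :
    augmentationLinear k X (Term.face k X 0 w) = 1 := by
  classical
  rw [augmentationLinear_apply, Term.coeff_face hw]
  simp

end Terms

end CentralArrangement

namespace CentralArrangement

/-! ### The boundary operator, its linearity and exactness. -/

section Resolution

variable {V : Type*} [AddCommGroup V] [Module ℝ V] [FiniteDimensional ℝ V]
  {A : CentralArrangement V} {k : Type*} [Field k] (o : A.Orientations) {X : A.Flat}

theorem hasCodimIn_succ_iff {w u : A.Face} {p : ℕ} (h : incidence o w u ≠ 0) (hu : u.supp ≤ X.1) :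
    w.HasCodimIn X (p + 1) ↔ u.HasCodimIn X p := by
  have h1 := finrank_of_incidence_ne_zero o h
  have h2 := Face.supp_mono (le_of_incidence_ne_zero o h)
  constructor
  · rintro ⟨_, h3⟩
    exact ⟨hu, by omega⟩
  · rintro ⟨_, h3⟩
    exact ⟨h2.trans hu, by omega⟩

theorem covBy_of_incidence_ne_zero {w u : A.Face} (h : incidence o w u ≠ 0) : w ⋖ u := by
  have hd := finrank_of_incidence_ne_zero o h
  have hlt {x y : A.Face} (hxy : x < y) :
      Module.finrank ℝ x.supp < Module.finrank ℝ y.supp :=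
    Submodule.finrank_lt_finrank_of_lt (lt_of_le_of_ne (Face.supp_mono hxy.le) fun h =>
      hxy.ne (Face.eq_of_le_of_supp_eq hxy.le h.ge))
  refine ⟨lt_of_le_of_ne (le_of_incidence_ne_zero o h) fun h' => ?_, fun c h1 h2 => ?_⟩
  · rw [h'] at hd; omega
  · have := hlt h1
    have := hlt h2
    omega

/-- The restriction to covers and the factor `χ_X` are redundant: a nonzero incidence number forces
a cover, and `Term.face` is zero outside `X`. -/
theorem boundaryOfFace_eq (p : ℕ) (w : A.Face) :
    boundaryOfFace k o X p w = ∑ u, (incidence o w u : k) • Term.face k X p u := by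
  classical
  rw [boundaryOfFace, Finset.sum_filter]
  refine Finset.sum_congr rfl fun u _ => ?_
  by_cases hu : u.HasCodimIn X p
  · have hchi : chi k X u = 1 := if_pos hu.1
    rw [hchi, mul_one]
    split_ifs with hwu
    · rfl
    · have : incidence o w u = 0 := by
        by_contra h
        exact hwu (covBy_of_incidence_ne_zero o h)
      rw [this, SignType.coe_zero, zero_smul]
  · rw [Term.face_eq_zero hu, smul_zero, smul_zero, ite_self]

/-- The boundary operator, as a `k`-linear map. -/
noncomputable def boundaryLinear (X : A.Flat) (p : ℕ) : Term k X (p + 1) →ₗ[k] Term k X p :=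
  ∑ w : A.Face, (LinearMap.proj w ∘ₗ Term.coeff).smulRight (boundaryOfFace k o X p w)

theorem boundaryLinear_apply (p : ℕ) (t : Term k X (p + 1)) :
    boundaryLinear o X p t = ∑ w, Term.coeff t w • boundaryOfFace k o X p w := by
  simp [boundaryLinear]

theorem boundaryLinear_face {p : ℕ} {w : A.Face} (h : w.HasCodimIn X (p + 1)) :
    boundaryLinear o X p (Term.face k X (p + 1) w) = boundaryOfFace k o X p w := by
  classical
  rw [boundaryLinear_apply, Term.coeff_face h, Finset.sum_eq_single w]
  · simp
  · intro u _ hu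
    rw [Pi.single_eq_of_ne hu, zero_smul]
  · simp

/-- Transposes `∂` to the coboundary of coefficients, so that exactness becomes a question about
functions on faces. -/
theorem coeff_boundaryLinear {p : ℕ} (t : Term k X (p + 1)) {u : A.Face} (hu : u.HasCodimIn X p) :
    Term.coeff (boundaryLinear o X p t) u = coboundary o k (Term.coeff t) u := by
  have : boundaryLinear o X p t = ∑ u, coboundary o k (Term.coeff t) u • Term.face k X p u := by
    simp only [boundaryLinear_apply, boundaryOfFace_eq, coboundary_apply, Finset.smul_sum,
      Finset.sum_smul]
    rw [Finset.sum_comm]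
    refine Finset.sum_congr rfl fun u _ => Finset.sum_congr rfl fun w _ => ?_
    rw [smul_smul, mul_comm]
  rw [this, Term.coeff_sum_smul_face _ u hu]

/-- Left multiplication by a face contained in `supp w` matches the faces above `w` with the faces
above its image. -/
theorem boundaryOfFace_mul {p : ℕ} {y w : A.Face} (hy : y.supp ≤ w.supp) :
    boundaryOfFace k o X p (y * w) =
      (MonoidAlgebra.single y 1 : A.FaceAlgebra k) • boundaryOfFace k o X p w := by
  classical
  -- Multiplication by `y` preserves both supports, and also the side of a hyperplane through `w`,
  -- since that hyperplane contains `y`.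
  have hinc {u : A.Face} (hwu : w ≤ u) : incidence o (y * w) (y * u) = incidence o w u := by
    have hyu : y.supp ≤ u.supp := hy.trans (Face.supp_mono hwu)
    have hle : y * w ≤ y * u := fun H => by
      rw [Face.sgn_mul, Face.sgn_mul]
      split_ifs with h
      · exact hwu H
      · exact Or.inr rfl
    by_cases h : incidence o w u = 0
    · by_contra h'
      rw [h] at h'
      obtain ⟨H, -, hu, s, hs, hsinc⟩ := exists_hyperplane_of_incidence_ne_zero o h'
      have h1 := hsinc w u (Face.supp_mul_of_le hy).symm (Face.supp_mul_of_le hyu).symm hwu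
      rw [h] at h1
      rcases mul_eq_zero.1 h1.symm with h1 | h1
      · exact hs h1
      · exact hu (Face.sgn_mul_eq_zero.2 ⟨Face.supp_le_supp.1 hyu H h1, h1⟩)
    · obtain ⟨H, hw, -, s, -, hsinc⟩ := exists_hyperplane_of_incidence_ne_zero o h
      rw [hsinc _ _ (Face.supp_mul_of_le hy) (Face.supp_mul_of_le hyu) hle, hsinc _ _ rfl rfl hwu,
        Face.sgn_mul, if_pos (Face.supp_le_supp.1 hy H hw)]
  rw [boundaryOfFace_eq, boundaryOfFace_eq, Finset.smul_sum]
  have hfilter (x : A.Face) (g : A.Face → Term k X p) :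
      ∑ u, (incidence o x u : k) • g u = ∑ u with x ≤ u, (incidence o x u : k) • g u := by
    refine (Finset.sum_filter_of_ne fun u _ h => ?_).symm
    by_contra h'
    exact h (by rw [incidence_eq_zero o fun h'' => h' h''.1, SignType.coe_zero, zero_smul])
  have hsmul (u : A.Face) : (MonoidAlgebra.single y 1 : A.FaceAlgebra k) •
      ((incidence o w u : k) • Term.face k X p u) = (incidence o w u : k) •
        ((MonoidAlgebra.single y 1 : A.FaceAlgebra k) • Term.face k X p u) := smul_comm _ _ _
  simp only [hsmul]
  rw [hfilter, hfilter]
  have hwy : w * y = w := Face.mul_eq_of_supp_le hy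
  have hyw : y * w * w = y * w :=
    Face.mul_eq_of_supp_le (Face.supp_le_mul_right _ _)
  -- As `w * y = w`, multiplication by `w` undoes multiplication by `y` on the faces above `w`.
  refine Finset.sum_bij' (fun u _ => w * u) (fun u _ => y * u) ?_ ?_ ?_ ?_ ?_
  · intro u _
    simp [Face.le_mul_right]
  · intro u hu
    have hwu : w ≤ u := (Finset.mem_filter.1 hu).2
    rw [Finset.mem_filter, ← Face.mul_eq_of_le hwu, ← mul_assoc]
    exact ⟨Finset.mem_univ _, Face.le_mul_right _ _⟩
  · intro u hu
    rw [← mul_assoc]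
    exact Face.mul_eq_of_le (Finset.mem_filter.1 hu).2
  · intro u hu
    rw [← mul_assoc, hwy]
    exact Face.mul_eq_of_le (Finset.mem_filter.1 hu).2
  · intro u hu
    have hu' := Face.mul_eq_of_le (Finset.mem_filter.1 hu).2
    have hyu : y.supp ≤ (w * u).supp := hy.trans (Face.supp_le_mul_left _ _)
    rw [Term.single_smul_face, if_pos hyu, ← hinc (Face.le_mul_right w u), ← mul_assoc, hu']

/-- A face not contained in `supp w` identifies opposite faces above `w`. -/
theorem single_smul_boundaryOfFace_eq_zero {p : ℕ} {y w : A.Face} (hy : ¬ y.supp ≤ w.supp) :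
    (MonoidAlgebra.single y 1 : A.FaceAlgebra k) • boundaryOfFace k o X p w = 0 := by
  have hsmul (u : A.Face) : (MonoidAlgebra.single y 1 : A.FaceAlgebra k) •
      ((incidence o w u : k) • Term.face k X p u) = (incidence o w u : k) •
        ((MonoidAlgebra.single y 1 : A.FaceAlgebra k) • Term.face k X p u) := smul_comm _ _ _
  rw [boundaryOfFace_eq, Finset.smul_sum]
  simp only [hsmul]
  refine sum_incidence_smul_eq_zero o k w _ fun u hu => ?_
  have hwu := le_of_incidence_ne_zero o hu
  have hd := finrank_of_incidence_ne_zero o hu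
  rw [Term.single_smul_face, Term.single_smul_face, Face.supp_mul_neg hwu]
  split_ifs with hyu
  · congr 1
    refine Face.eq_of_le_of_le (Face.le_mul_right _ _) (Face.le_mul_right _ _) fun H hH => ?_
    rw [Face.sgn_mul, Face.sgn_mul y u, if_pos hH, if_pos hH, Face.sgn_mul]
    split_ifs with hw
    -- Otherwise `H` would cut `supp u` in `supp w`; as `supp y` lies in both `supp u` and `H`, it
    -- would lie in `supp w`.
    · have huH : u.sgn H = 0 := by
        by_contra h
        have hiff := form_eq_zero_iff_of_finrank (Face.supp_mono hwu) hd
          (Face.supp_le_hyperplane.2 hw) fun h' => h (Face.supp_le_hyperplane.1 h')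
        refine hy fun v hv => (hiff v (hyu hv)).1 ?_
        exact Face.mem_supp.1 hv H hH
      rw [Face.sgn_neg, huH, neg_zero]
    · exact (hwu H).resolve_left hw
  · rfl

/-- The boundary operator `∂`. -/
noncomputable def boundary (k : Type*) [Field k] (X : A.Flat) (p : ℕ) :
    Term k X (p + 1) →ₗ[A.FaceAlgebra k] Term k X p :=
  MonoidAlgebra.equivariantOfLinearOfComm (boundaryLinear o X p) fun y t => by
    classical
    rw [← Term.sum_coeff_smul_face t, map_sum, Finset.smul_sum, Finset.smul_sum, map_sum]
    refine Finset.sum_congr rfl fun w _ => ?_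
    rw [smul_comm, LinearMap.map_smul, LinearMap.map_smul, smul_comm (MonoidAlgebra.single y 1 : A.FaceAlgebra k)]
    congr 1
    by_cases hw : w.HasCodimIn X (p + 1)
    · rw [Term.single_smul_face, boundaryLinear_face o hw]
      split_ifs with hy
      · rw [boundaryLinear_face, boundaryOfFace_mul o hy]
        rwa [Face.HasCodimIn, Face.supp_mul_of_le hy]
      · rw [map_zero, single_smul_boundaryOfFace_eq_zero o hy]
    · rw [Term.face_eq_zero hw, smul_zero, map_zero, smul_zero]

theorem boundary_apply (p : ℕ) (t : Term k X (p + 1)) :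
    boundary o k X p t = boundaryLinear o X p t := rfl

theorem supp_eq_of_hasCodimIn_zero {w : A.Face} (hw : w.HasCodimIn X 0) : w.supp = X.1 :=
  Submodule.eq_of_le_of_finrank_le hw.1 (by have := hw.2; omega)

/-- The augmentation `kF_X → k_X`. -/
noncomputable def augmentation (k : Type*) [Field k] (X : A.Flat) :
    Term k X 0 →ₗ[A.FaceAlgebra k] SimpleMod k X :=
  MonoidAlgebra.equivariantOfLinearOfComm
    ((simpleRep k X).asModuleEquiv.symm.toLinearMap ∘ₗ augmentationLinear k X) fun y t => by
    classical
    have hact (a : k) : (MonoidAlgebra.single y 1 : A.FaceAlgebra k) •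
        (simpleRep k X).asModuleEquiv.symm a = (simpleRep k X).asModuleEquiv.symm (chi k X y * a) := by
      rw [← simpleRep_apply, Representation.asModuleEquiv_symm_map_rho]; rfl
    simp only [LinearMap.comp_apply, LinearEquiv.coe_coe]
    rw [hact]
    congr 1
    rw [← Term.sum_coeff_smul_face t, map_sum, Finset.smul_sum, Finset.mul_sum, map_sum]
    refine Finset.sum_congr rfl fun w _ => ?_
    rw [smul_comm, LinearMap.map_smul, LinearMap.map_smul, smul_eq_mul, smul_eq_mul, mul_left_comm]
    congr 1
    by_cases hw : w.HasCodimIn X 0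
    · have hwX := supp_eq_of_hasCodimIn_zero hw
      rw [Term.single_smul_face, augmentationLinear_face hw, mul_one, hwX]
      by_cases hy : y.supp ≤ X.1
      · have hchi : chi k X y = 1 := if_pos hy
        rw [if_pos hy, hchi, augmentationLinear_face]
        rwa [Face.HasCodimIn, Face.supp_mul_of_le (hwX ▸ hy)]
      · have hchi : chi k X y = 0 := if_neg hy
        rw [if_neg hy, hchi, map_zero]
    · rw [Term.face_eq_zero hw, smul_zero, map_zero, mul_zero]

theorem asModuleEquiv_augmentation (t : Term k X 0) :
    (simpleRep k X).asModuleEquiv (augmentation k X t) = augmentationLinear k X t :=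
  (simpleRep k X).asModuleEquiv.apply_symm_apply _

open Classical in
theorem augmentationLinear_eq (t : Term k X 0) :
    augmentationLinear k X t = ∑ w with w.supp = X.1, Term.coeff t w := by
  rw [augmentationLinear_apply]
  refine (Finset.sum_filter_of_ne fun w _ h => ?_).symm
  by_contra h'
  exact h (Term.coeff_of_not fun hw => h' (supp_eq_of_hasCodimIn_zero hw))

open Classical in
theorem exists_boundaryLinear_eq {p : ℕ} (t : Term k X p)
    (h : ∀ u : A.Face, u.supp ≤ X.1 → coboundary o k (Term.coeff t) u = 0)
    (hsum : ∑ w with w.supp = X.1, Term.coeff t w = 0) :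
    ∃ s : Term k X (p + 1), boundaryLinear o X p s = t := by
  have hcodim {w : A.Face} (hw : Term.coeff t w ≠ 0) : w.HasCodimIn X p := by
    by_contra h'
    exact hw (Term.coeff_of_not h')
  -- No sign is prescribed, so the region is all of `X`. The solution `b` need not be homogeneous;
  -- only its part in codimension `p + 1` is kept, since no other part contributes in codimension
  -- `p`.
  obtain ⟨b, -, hbc⟩ := exists_coboundary_eq o k _ X (fun _ => 0) le_rfl (Term.coeff t)
    (fun w hw => ⟨(hcodim hw).1, fun H hH => absurd rfl hH⟩) h hsum
  refine ⟨∑ w, b w • Term.face k X (p + 1) w, Term.coeff_injective (funext fun u => ?_)⟩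
  by_cases hu : u.HasCodimIn X p
  · rw [coeff_boundaryLinear o _ hu, ← hbc u hu.1]
    refine coboundary_congr o fun w hw => ?_
    exact Term.coeff_sum_smul_face b w ((hasCodimIn_succ_iff o hw hu.1).2 hu)
  · rw [Term.coeff_of_not hu, Term.coeff_of_not hu]

theorem exact_boundary_boundary (p : ℕ) :
    Function.Exact (boundary o k X (p + 1)) (boundary o k X p) := by
  classical
  intro t
  simp only [Set.mem_range, boundary_apply]
  constructor
  · intro ht
    refine exists_boundaryLinear_eq o t (fun u hu => ?_) (Finset.sum_eq_zero fun w hw => ?_)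
    · by_cases hp : u.HasCodimIn X p
      · rw [← coeff_boundaryLinear o t hp, ht, map_zero, Pi.zero_apply]
      · exact coboundary_eq_zero o fun w hw => Term.coeff_of_not fun hw' =>
          hp ((hasCodimIn_succ_iff o hw hu).1 hw')
    -- An element of positive codimension `p + 1` involves no face of support `X`, so the condition
    -- on the sum is automatic.
    · refine Term.coeff_of_not fun h => ?_
      have h1 := h.2
      rw [(Finset.mem_filter.1 hw).2] at h1
      omega
  · rintro ⟨s, rfl⟩
    refine Term.coeff_injective (funext fun u => ?_)
    rw [map_zero, Pi.zero_apply]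
    by_cases hu : u.HasCodimIn X p
    · rw [coeff_boundaryLinear o _ hu]
      refine (coboundary_congr o (c' := coboundary o k (Term.coeff s)) fun w hw => ?_).trans ?_
      · exact coeff_boundaryLinear o s ((hasCodimIn_succ_iff o hw hu.1).2 hu)
      · rw [coboundary_coboundary, Pi.zero_apply]
    · exact Term.coeff_of_not hu

theorem exact_boundary_augmentation :
    Function.Exact (boundary o k X 0) (augmentation k X) := by
  classical
  intro t
  rw [← (simpleRep k X).asModuleEquiv.map_eq_zero_iff, asModuleEquiv_augmentation,
    augmentationLinear_eq]
  simp only [Set.mem_range, boundary_apply]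
  constructor
  · intro ht
    refine exists_boundaryLinear_eq o t (fun u hu => ?_) ht
    -- In codimension zero every element is a cocycle, as no face inside `X` has larger dimension.
    refine coboundary_eq_zero o fun w hw => Term.coeff_of_not fun h => ?_
    have h1 := finrank_of_incidence_ne_zero o hw
    have h2 := Submodule.finrank_mono hu
    have h3 := h.2
    omega
  · rintro ⟨s, rfl⟩
    rw [← sum_coboundary_supp_eq o X (Term.coeff s)]
    refine Finset.sum_congr rfl fun u hu => coeff_boundaryLinear o s ?_
    have hu' := (Finset.mem_filter.1 hu).2
    exact ⟨hu'.le, by rw [hu', add_zero]⟩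

theorem augmentation_surjective : Function.Surjective (augmentation k X) := by
  intro m
  obtain ⟨x, hx⟩ : ∃ x : A.Face, x.supp = X.1 := X.2
  refine ⟨(simpleRep k X).asModuleEquiv m • Term.face k X 0 x,
    (simpleRep k X).asModuleEquiv.injective ?_⟩
  rw [asModuleEquiv_augmentation, map_smul, augmentationLinear_face ⟨hx.le, by rw [hx, add_zero]⟩,
    smul_eq_mul, mul_one]

end Resolution

end CentralArrangement

theorem mainTheorem4 {V : Type*} [AddCommGroup V] [Module ℝ V] [FiniteDimensional ℝ V]
    (A : CentralArrangement V) (k : Type*) [Field k] (o : A.Orientations) (X : A.Flat) :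
    IsSimpleModule (A.FaceAlgebra k) (CentralArrangement.SimpleMod k X) ∧
    ∃ (d : ∀ p : ℕ, CentralArrangement.Term k X (p + 1) →ₗ[A.FaceAlgebra k]
          CentralArrangement.Term k X p)
      (ε : CentralArrangement.Term k X 0 →ₗ[A.FaceAlgebra k] CentralArrangement.SimpleMod k X),
      (∀ (p : ℕ) (w : A.Face), w.HasCodimIn X (p + 1) →
        d p (CentralArrangement.Term.face k X (p + 1) w) =
          CentralArrangement.boundaryOfFace k o X p w) ∧
      (∀ w : A.Face, w.HasCodimIn X 0 →
        (CentralArrangement.simpleRep k X).asModuleEquiv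
          (ε (CentralArrangement.Term.face k X 0 w)) = 1) ∧
      IsProjectiveResolution (P := CentralArrangement.Term k X) d ε := by
  refine ⟨CentralArrangement.isSimpleModule_simpleMod k X, CentralArrangement.boundary o k X,
    CentralArrangement.augmentation k X,
    fun p w hw => CentralArrangement.boundaryLinear_face o hw, fun w hw => ?_, ?_⟩
  · rw [CentralArrangement.asModuleEquiv_augmentation,
      CentralArrangement.augmentationLinear_face hw]
  · exact
      { projective := fun p => by
          have (Y : A.Flat) := CentralArrangement.projective_flatMod k Y
          infer_instance
        exact_succ := CentralArrangement.exact_boundary_boundary o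
        exact_zero := CentralArrangement.exact_boundary_augmentation o
        surjective := CentralArrangement.augmentation_surjective }
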